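/- **Setting.** Let $n\ge 1$, identify $\mathbb H^n\cong\mathbb R^{4n}$ by $q_l=x_{4l}+\mathbf i x_{4l+1}+\mathbf j x_{4l+2}+\mathbf k x_{4l+3}$ ($0\le l\le n-1$), and let $\Omega\subset\mathbb H^n$ be open. A function $u:\Omega\to[-\infty,\infty)$ is *plurisubharmonic* (PSH) if it is upper semicontinuous and its restriction to (the part in $\Omega$ of) each right quaternionic line $\{a+v\lambda:\lambda\in\mathbb H\}$, $v\neq0$, is subharmonic, i.e. satisfies the sub-mean value inequality for spheres bounding closed balls ($\equiv-\infty$ being allowed on a line). Let $\omega^0,\dots,\omega^{2n-1}$ be the standard basis of $\mathbb C^{2n}$, $\Omega_{2n}=\omega^0\wedge\dots\wedge\omega^{2n-1}$, and $$\nabla_{(2l)0}=\partial_{x_{4l}}+i\partial_{x_{4l+1}},\quad \nabla_{(2l)1}=-\partial_{x_{4l+2}}-i\partial_{x_{4l+3}},\quad \nabla_{(2l+1)0}=\partial_{x_{4l+2}}-i\partial_{x_{4l+3}},\quad \nabla_{(2l+1)1}=\partial_{x_{4l}}-i\partial_{x_{4l+1}}.$$ For a form $F=\sum_I f_I\omega^I$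 with values in $\wedge^p\mathbb C^{2n}$ put $d_\alpha F=\sum_{k,I}\nabla_{k\alpha}f_I\,\omega^k\wedge\omega^I$ ($\alpha=0,1$) and $\triangle F=d_0d_1F$. A *$p$-current* is a continuous linear functional on the space $\mathcal D^{2n-p}(\Omega)=C_0^\infty(\Omega,\wedge^{2n-p}\mathbb C^{2n})$ of test forms; $(d_\alpha T)(\eta)=-T(d_\alpha\eta)$ and $(\triangle T)(\eta)=T(\triangle\eta)$, and $T$ is *closed* if $d_0T=d_1T=0$. A locally integrable $p$-form $\psi$ defines the $p$-current $T_\psi(\varphi)=\int_\Omega\psi\wedge\varphi$, where $\int_\Omega f\,\Omega_{2n}:=\int_\Omega f\,dV$. For a right $\mathbb H$-linear map $\eta:\mathbb H^n\to\mathbb H$, $\eta(q)=\sum_l a_lq_l$, let $\eta^*\tilde\omega^\varepsilon=\sum_{l}\sum_{\delta\in\{0,1\}}\tau(a_l)_{\varepsilon\delta}\,\omega^{2l+\delta}$ ($\varepsilon=0,1$), where $$\tau(x_0+\mathbf ix_1+\mathbf jx_2+\mathbf kx_3)=\begin{pmatrix}x_0-ix_1&-x_2+ix_3\\x_2+ix_3&x_0+ix_1\end{pmatrix}.$$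 $SP^{2k}\mathbb C^{2n}$, the cone of *strongly positive* elements, consists of the finite combinations with non-negative coefficients of elements $\eta_1^*\tilde\omega^0\wedge\eta_1^*\tilde\omega^1\wedge\dots\wedge\eta_k^*\tilde\omega^0\wedge\eta_k^*\tilde\omega^1$ with $\eta_1,\dots,\eta_k$ linearly independent right $\mathbb H$-linear maps. A $2k$-form is strongly positive if its value at each point of $\Omega$ is; a $2k$-current $T$ is *positive* if $T(\eta)\ge0$ for all $\eta\in C_0^\infty(\Omega,SP^{2n-2k}\mathbb C^{2n})$. **Proposition.** (a) Let $u$ be PSH on $\Omega$ and not identically $-\infty$ on any connected component of $\Omega$. Then $u$ is finite almost everywhere and locally integrable on $\Omega$, so that it defines a $0$-current, and the $2$-current $\triangle u$, $(\triangle u)(\eta)=\int_\Omega u\,\triangle\eta$, is closed and positive. (b) If $u$ is a real valued PSH function of class $C^2$ on $\Omega$, then $\triangle u$ is a closed strongly positive $2$-form: $\triangle u(q)\in SP^2\mathbb C^{2n}$ for every $q\in\Omega$, the $2$-current $\triangle u$ of (a) is the one defined by the continuous $2$-form $\triangle u$, and this current is closed. If $u$ is moreover of class $C^3$, then $d_0\triangle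 u=d_1\triangle u=0$ pointwise on $\Omega$. -/

import Mathlib

open MeasureTheory TopologicalSpace
open scoped Quaternion Distributions ENNReal

noncomputable section

namespace QPot

/-! ### The space `ℍⁿ` and Lebesgue measure -/

/-- The quaternions carry their Borel σ-algebra. -/
instance instMeasurableSpaceQuaternion : MeasurableSpace ℍ[ℝ] := borel ℍ[ℝ]

instance instBorelSpaceQuaternion : BorelSpace ℍ[ℝ] := ⟨rfl⟩

/-- Lebesgue measure on `ℍ ≅ ℝ⁴`; on `ℍⁿ = Fin n → ℍ` the product measure `dV` is then Lebesgue
measure on `ℝ⁴ⁿ`. -/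
instance instMeasureSpaceQuaternion : MeasureSpace ℍ[ℝ] := measureSpaceOfInnerProductSpace

/-- `ℍⁿ`. Its (product) topology and its differentiable structure are those of `ℝ⁴ⁿ`. -/
abbrev HSpace (n : ℕ) : Type := Fin n → ℍ[ℝ]

/-! ### Plurisubharmonic functions -/

/-- The integral `∫ f⁺ dμ - ∫ f⁻ dμ ∈ [-∞, ∞]` of an extended real valued function. (For an upper
semicontinuous `f < +∞` on a compact space and finite `μ`, the first term is finite.) -/
def extIntegral {X : Type*} [MeasurableSpace X] (μ : Measure X) (f : X → EReal) : EReal :=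
  ((∫⁻ x, (f x).toENNReal ∂μ : ℝ≥0∞) : EReal) - ((∫⁻ x, (-f x).toENNReal ∂μ : ℝ≥0∞) : EReal)

/-- The normalized surface measure on the unit sphere of `ℍ ≅ ℝ⁴`. -/
def sphereProb : Measure (Metric.sphere (0 : ℍ[ℝ]) 1) :=
  ((volume : Measure ℍ[ℝ]).toSphere Set.univ)⁻¹ • (volume : Measure ℍ[ℝ]).toSphere

/-- The integral average of `f` over the sphere of centre `x` and radius `r` in `ℍ`. -/
def sphereMean (f : ℍ[ℝ] → EReal) (x : ℍ[ℝ]) (r : ℝ) : EReal :=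
  extIntegral sphereProb fun ξ => f (x + r • (ξ : ℍ[ℝ]))

/-- `f` is subharmonic on the open set `D ⊆ ℍ ≅ ℝ⁴`: it is upper semicontinuous with values in
`[-∞, ∞)` and satisfies the sub-mean value inequality on every closed ball contained in `D`.
The value `-∞` is allowed, also identically. -/
structure IsSubharmonicOn (D : Set ℍ[ℝ]) (f : ℍ[ℝ] → EReal) : Prop where
  usc : UpperSemicontinuousOn f D
  lt_top : ∀ x ∈ D, f x < ⊤
  le_mean : ∀ (x : ℍ[ℝ]) (r : ℝ), 0 < r → Metric.closedBall x r ⊆ D → f x ≤ sphereMean f x r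

/-- The parametrization `λ ↦ a + v λ` of the right quaternionic line through `a` in direction
`v`. -/
def rightLine {n : ℕ} (a v : HSpace n) (t : ℍ[ℝ]) : HSpace n := fun l => a l + v l * t

/-- `u` is plurisubharmonic on `Ω ⊆ ℍⁿ`: it is upper semicontinuous with values in `[-∞, ∞)` and
subharmonic on (the part in `Ω` of) each right quaternionic line. -/
structure IsPSH {n : ℕ} (Ω : Opens (HSpace n)) (u : HSpace n → EReal) : Prop where
  usc : UpperSemicontinuousOn u Ω
  lt_top : ∀ q ∈ Ω, u q < ⊤
  subharmonic : ∀ a v : HSpace n, v ≠ 0 →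
    IsSubharmonicOn {t | rightLine a v t ∈ Ω} fun t => u (rightLine a v t)

/-! ### The exterior algebra of `ℂ²ⁿ` -/

/-- `ℂ²ⁿ`, with its standard basis as the basis `ω⁰, …, ω²ⁿ⁻¹`. -/
abbrev CSpace (n : ℕ) : Type := Fin (2 * n) → ℂ

/-- The full exterior algebra `∧ ℂ²ⁿ`; its product is the wedge product. -/
abbrev Ext (n : ℕ) : Type := ExteriorAlgebra ℂ (CSpace n)

/-- `∧ᵖ ℂ²ⁿ`, as a complex vector space of its own. -/
def ExtPow (n p : ℕ) : Type := ↥(⋀[ℂ]^p (CSpace n))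

instance instAddCommGroupExtPow (n p : ℕ) : AddCommGroup (ExtPow n p) :=
  inferInstanceAs (AddCommGroup ↥(⋀[ℂ]^p (CSpace n)))

instance instModuleExtPow (n p : ℕ) : Module ℂ (ExtPow n p) :=
  inferInstanceAs (Module ℂ ↥(⋀[ℂ]^p (CSpace n)))

instance instFiniteExtPow (n p : ℕ) : Module.Finite ℂ (ExtPow n p) :=
  inferInstanceAs (Module.Finite ℂ ↥(⋀[ℂ]^p (CSpace n)))

/-- The inclusion `∧ᵖ ℂ²ⁿ ⊆ ∧ ℂ²ⁿ`. -/
def toExt {n p : ℕ} : ExtPow n p →ₗ[ℂ] Ext n := (⋀[ℂ]^p (CSpace n)).subtype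

/-- `ωʲ` as an element of the exterior algebra. -/
def omega {n : ℕ} (j : Fin (2 * n)) : Ext n := ExteriorAlgebra.ι ℂ (Pi.single j 1)

/-- The coefficients `f_I` of an element `∑_I f_I ω^I` of `∧ᵖ ℂ²ⁿ`, the sum being over increasing
multi-indices `I`. -/
def coeffs (n p : ℕ) :
    ExtPow n p ≃ₗ[ℂ] (Set.powersetCard (Fin (2 * n)) p → ℂ) :=
  ((Pi.basisFun ℂ (Fin (2 * n))).exteriorPower p).equivFun

/-- The norm `max_I |f_I|`. It only serves to speak of smooth functions with values in the
finite dimensional space `∧ᵖ ℂ²ⁿ`, where all norms are equivalent. -/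
instance instNormedAddCommGroupExtPow (n p : ℕ) : NormedAddCommGroup (ExtPow n p) :=
  NormedAddCommGroup.induced _ _ (coeffs n p) (coeffs n p).injective

instance instNormedSpaceExtPow (n p : ℕ) : NormedSpace ℂ (ExtPow n p) :=
  NormedSpace.induced ℂ _ _ (coeffs n p)

/-- The coefficient of `Ω₂ₙ = ω⁰ ∧ ω¹ ∧ ⋯ ∧ ω²ⁿ⁻¹`: the linear form on `∧ ℂ²ⁿ` that vanishes on
`∧ᵖ ℂ²ⁿ` for `p ≠ 2n` and sends `v₀ ∧ ⋯ ∧ v₂ₙ₋₁` to `det (v₀, …, v₂ₙ₋₁)`. -/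
def topCoeff (n : ℕ) : Ext n →ₗ[ℂ] ℂ :=
  ExteriorAlgebra.liftAlternating
    (Pi.single (2 * n) (Matrix.detRowAlternating (n := Fin (2 * n)) (R := ℂ)))

theorem omega_mul_mem {n k m : ℕ} (h : k + 1 = m) (j : Fin (2 * n)) (x : ExtPow n k) :
    omega j * toExt x ∈ ⋀[ℂ]^m (CSpace n) := by
  subst h
  have h1 := Submodule.mul_mem_mul (LinearMap.mem_range_self (ExteriorAlgebra.ι ℂ)
    (Pi.single j 1 : CSpace n)) x.2
  have h2 := pow_succ' (LinearMap.range (ExteriorAlgebra.ι ℂ (M := CSpace n))) k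
  rw [← h2] at h1
  exact h1

/-- `x ↦ ωʲ ∧ x` from `∧ᵏ ℂ²ⁿ` to `∧ᵏ⁺¹ ℂ²ⁿ`. -/
def wedgeLeft {n k m : ℕ} (h : k + 1 = m) (j : Fin (2 * n)) : ExtPow n k →L[ℂ] ExtPow n m :=
  LinearMap.toContinuousLinearMap
    { toFun := fun x => ⟨omega j * toExt x, omega_mul_mem h j x⟩
      map_add' := fun _ _ => Subtype.ext (mul_add _ _ _)
      map_smul' := fun c _ => Subtype.ext (mul_smul_comm c _ _) }

/-! ### Strongly positive elements -/

/-- The `(ε, δ)` entry of the `2 × 2` complex matrix `τ(a)` of a quaternion `a`, `ε, δ ∈ {0, 1}`. -/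
def tau (a : ℍ[ℝ]) (ε δ : Fin 2) : ℂ :=
  !![(a.re : ℂ) - Complex.I * a.imI, -(a.imJ : ℂ) + Complex.I * a.imK;
     (a.imJ : ℂ) + Complex.I * a.imK, (a.re : ℂ) + Complex.I * a.imI] ε δ

/-- For `j = 2l + ε` with `ε ∈ {0, 1}`, the index `l`. -/
def blk {n : ℕ} (j : Fin (2 * n)) : Fin n := ⟨(j : ℕ) / 2, by have := j.2; omega⟩

/-- For `j = 2l + ε` with `ε ∈ {0, 1}`, the index `ε`. -/
def par {n : ℕ} (j : Fin (2 * n)) : Fin 2 := ⟨(j : ℕ) % 2, Nat.mod_lt _ two_pos⟩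

/-- Right `ℍ`-linear maps `ℍⁿ → ℍ`; a left `ℍ`-module. -/
abbrev RightLin (n : ℕ) : Type := HSpace n →ₗ[ℍ[ℝ]ᵐᵒᵖ] ℍ[ℝ]

/-- `η^* ω̃^ε = ∑_j τ(η)_{ε j} ωʲ`, where `τ(η) = (τ(η₀), …, τ(ηₙ₋₁))` is the complex
`2 × 2n` matrix of `η = (η₀, …, ηₙ₋₁)`, `η_l = η(e_l)`, and `ω̃⁰, ω̃¹` is the standard basis of
`ℂ²`. -/
def pullback {n : ℕ} (η : RightLin n) (ε : Fin 2) : Ext n :=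
  ExteriorAlgebra.ι ℂ fun j : Fin (2 * n) => tau (η (Pi.single (blk j) 1)) ε (par j)

/-- `x = η₁^*ω̃⁰ ∧ η₁^*ω̃¹ ∧ ⋯ ∧ η_k^*ω̃⁰ ∧ η_k^*ω̃¹` for some (left `ℍ`-) linearly independent
right `ℍ`-linear maps `η₁, …, η_k : ℍⁿ → ℍ`. -/
def IsElementaryStronglyPositive {n : ℕ} (k : ℕ) (x : Ext n) : Prop :=
  ∃ η : Fin k → RightLin n, LinearIndependent ℍ[ℝ] η ∧
    x = (List.ofFn fun i => pullback (η i) 0 * pullback (η i) 1).prod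

/-- The convex cone `SP²ᵏ ℂ²ⁿ`: finite combinations of elementary strongly positive elements with
non-negative real coefficients. -/
def IsStronglyPositive {n : ℕ} (k : ℕ) (x : Ext n) : Prop :=
  ∃ (m : ℕ) (c : Fin m → ℝ) (ξ : Fin m → Ext n), (∀ i, 0 ≤ c i) ∧
    (∀ i, IsElementaryStronglyPositive k (ξ i)) ∧ x = ∑ i, (c i : ℂ) • ξ i

/-! ### The operators `∇_{jα}`, `d₀`, `d₁` and the Baston operator on forms -/

/-- The quaternion `𝐢`. -/
def unitI : ℍ[ℝ] := ⟨0, 1, 0, 0⟩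

/-- The quaternion `𝐣`. -/
def unitJ : ℍ[ℝ] := ⟨0, 0, 1, 0⟩

/-- The quaternion `𝐤 = 𝐢𝐣`. -/
def unitK : ℍ[ℝ] := ⟨0, 0, 0, 1⟩

/-- The first-order operators `∇_{jα}`, `j = 2l + ε`, have the form `∂_a + i ∂_b`, with real
directions `a`, `b` in the `l`-th factor of `ℍⁿ`. This is the pair `(a, b)`:
`∇_{(2l)0} = ∂_{x_{4l}} + i ∂_{x_{4l+1}}`, `∇_{(2l)1} = -∂_{x_{4l+2}} - i ∂_{x_{4l+3}}`,
`∇_{(2l+1)0} = ∂_{x_{4l+2}} - i ∂_{x_{4l+3}}`, `∇_{(2l+1)1} = ∂_{x_{4l}} - i ∂_{x_{4l+1}}`,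
where `q_l = x_{4l} + 𝐢 x_{4l+1} + 𝐣 x_{4l+2} + 𝐤 x_{4l+3}`. -/
def nablaDir (ε α : Fin 2) : ℍ[ℝ] × ℍ[ℝ] :=
  !![(1, unitI), (-unitJ, -unitK); (unitJ, -unitK), (1, -unitI)] ε α

/-- The direction `a` of `∇_{jα} = ∂_a + i ∂_b`. -/
def dirRe {n : ℕ} (j : Fin (2 * n)) (α : Fin 2) : HSpace n :=
  Pi.single (blk j) (nablaDir (par j) α).1

/-- The direction `b` of `∇_{jα} = ∂_a + i ∂_b`. -/
def dirIm {n : ℕ} (j : Fin (2 * n)) (α : Fin 2) : HSpace n :=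
  Pi.single (blk j) (nablaDir (par j) α).2

/-- `∇_{jα} F` for a function `F` on (an open subset of) `ℍⁿ`. -/
def nabla {n : ℕ} {W : Type*} [NormedAddCommGroup W] [NormedSpace ℂ W] (j : Fin (2 * n))
    (α : Fin 2) (F : HSpace n → W) (q : HSpace n) : W :=
  fderiv ℝ F q (dirRe j α) + Complex.I • fderiv ℝ F q (dirIm j α)

/-- `d_α F = ∑_j ωʲ ∧ ∇_{jα} F` for a form `F`. -/
def dForm {n k m : ℕ} (α : Fin 2) (h : k + 1 = m) (F : HSpace n → ExtPow n k) :
    HSpace n → ExtPow n m :=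
  fun q => ∑ j, wedgeLeft h j (nabla j α F q)

/-- `1 ∈ ∧⁰ ℂ²ⁿ = ℂ`. -/
def oneForm (n : ℕ) : ExtPow n 0 :=
  ⟨1, (pow_zero (LinearMap.range (ExteriorAlgebra.ι ℂ (M := CSpace n)))).ge
    (Submodule.one_le.mp le_rfl)⟩

/-- A complex valued function as a `0`-form. -/
def scalarForm {n : ℕ} (f : HSpace n → ℂ) : HSpace n → ExtPow n 0 :=
  fun q => f q • oneForm n

/-- The Baston operator `△ v = d₀ d₁ v` on functions. -/
def bastonForm {n : ℕ} (v : HSpace n → ℝ) : HSpace n → ExtPow n 2 :=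
  dForm 0 rfl (dForm 1 rfl (scalarForm fun q => (v q : ℂ)))

/-! ### Test forms and currents -/

/-- The space `𝒟ᵖ(Ω) = C₀^∞(Ω, ∧ᵖ ℂ²ⁿ)` of test `p`-forms, with its usual LF topology. -/
abbrev TestForm {n : ℕ} (Ω : Opens (HSpace n)) (p : ℕ) : Type := 𝓓(Ω, ExtPow n p)

/-- `d_α : 𝒟ᵏ(Ω) → 𝒟ᵏ⁺¹(Ω)`, `d_α η = ∑_j ωʲ ∧ ∇_{jα} η`. -/
def dTest {n k m : ℕ} {Ω : Opens (HSpace n)} (α : Fin 2) (h : k + 1 = m) :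
    TestForm Ω k →L[ℂ] TestForm Ω m :=
  ∑ j, (TestFunction.postcompCLM (wedgeLeft h j) ∘L TestFunction.lineDerivCLM ℂ (dirRe j α) +
    TestFunction.postcompCLM (Complex.I • wedgeLeft h j) ∘L
      TestFunction.lineDerivCLM ℂ (dirIm j α))

/-- On test forms, `dTest` is the operator `dForm`. -/
theorem dTest_apply {n k m : ℕ} {Ω : Opens (HSpace n)} (α : Fin 2) (h : k + 1 = m)
    (η : TestForm Ω k) (q : HSpace n) : dTest α h η q = dForm α h η q := by
  have hd : DifferentiableAt ℝ η q := (η.contDiff.differentiable (by simp)).differentiableAt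
  simp [dTest, dForm, nabla, hd.lineDeriv_eq_fderiv, TestFunction.lineDerivCLM_apply]

/-- `p`-currents on `Ω`: the elements of the dual space of `𝒟²ⁿ⁻ᵖ(Ω)`. (Used for `p ≤ 2n`.) -/
abbrev Current {n : ℕ} (Ω : Opens (HSpace n)) (p : ℕ) : Type :=
  TestForm Ω (2 * n - p) →L[ℂ] ℂ

/-- `(d_α T)(η) = -T(d_α η)`. -/
def dCurrent {n p : ℕ} {Ω : Opens (HSpace n)} (α : Fin 2) (h : p + 1 ≤ 2 * n)
    (T : Current Ω p) : Current Ω (p + 1) :=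
  -(T ∘L dTest α (by omega))

/-- `(△ T)(η) = T(△ η) = T(d₀ d₁ η)`. -/
def bastonCurrent {n p : ℕ} {Ω : Opens (HSpace n)} (h : p + 2 ≤ 2 * n)
    (T : Current Ω p) : Current Ω (p + 2) :=
  T ∘L dTest 0 (show (2 * n - (p + 2) + 1) + 1 = 2 * n - p by omega) ∘L dTest 1 rfl

/-- A current is closed if `d₀ T = d₁ T = 0`. (For `p ≥ 2n` there is nothing to require, as
there are no `(p+1)`-currents.) -/
def IsClosedCurrent {n p : ℕ} {Ω : Opens (HSpace n)} (T : Current Ω p) : Prop :=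
  ∀ (α : Fin 2) (h : p + 1 ≤ 2 * n), dCurrent α h T = 0

/-- A `2k`-current is positive if `T(η) ≥ 0` for each `η ∈ C₀^∞(Ω, SP²ⁿ⁻²ᵏ ℂ²ⁿ)`. -/
def IsPositiveCurrent {n : ℕ} (k : ℕ) {Ω : Opens (HSpace n)} (T : Current Ω (2 * k)) : Prop :=
  ∀ η : TestForm Ω (2 * n - 2 * k), (∀ q, IsStronglyPositive (n - k) (toExt (η q))) →
    0 ≤ (T η).re ∧ (T η).im = 0

/-- `T` is the current `T_ψ` associated with a locally integrable `p`-form `ψ` on `Ω`: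
`T(φ) = ∫_Ω ψ ∧ φ`, where `∫_Ω f Ω₂ₙ = ∫_Ω f dV`. -/
def IsCurrentOf {n p : ℕ} {Ω : Opens (HSpace n)} (T : Current Ω p)
    (ψ : HSpace n → ExtPow n p) : Prop :=
  LocallyIntegrableOn ψ (Ω : Set (HSpace n)) ∧
    ∀ φ : TestForm Ω (2 * n - p),
      T φ = ∫ q in (Ω : Set (HSpace n)), topCoeff n (toExt (ψ q) * toExt (φ q))

end QPot

end

open QPot

/-! The link between the analysis and the algebra is the trace `∑ e, B (v e) (v e)`, `e = 1, 𝐢, 𝐣,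
𝐤`, of a real symmetric form `B` on the right quaternionic line spanned by `v`.

Analysis. The mean of a quadratic form over the unit sphere of `ℍ` is a quarter of its trace and
linear terms have mean zero, so a second order Taylor expansion turns the sub-mean value inequality
on small spheres into non-negativity of this trace for the second derivative
(`sum_sndFDeriv_nonneg`).

Algebra. At a point, `△u` depends linearly on the second derivative `B` through the element `baston
B`, and replacing `B` by `B(· e, · e)` does not change it. Hence `B` may be replaced by its average
over the four units, whose values on the diagonal are a quarter of the traces and so non-negative.
Diagonalizing the average writes it as a non-negative combination of squares of real linear forms.
The square of `f` has Baston element `η^*ω̃⁰ ∧ η^*ω̃¹`, where `η` is the right linear map with real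
part `f`; so `baston B` is strongly positive (`isStronglyPositive_baston`). This is the pointwise
claim of (b).

For (a), averaging over right multiplications by unit quaternions bounds the integral of `M - u`
over a ball by its value at the centre. A connectedness argument then gives finiteness almost
everywhere and local integrability. Mollifications of `u` are smooth and keep the sub-mean value
inequality, so their Baston forms are strongly positive near the support of the test form. The
product with a strongly positive form of complementary degree has non-negative top coefficient,
because the complex determinant of a quaternionic matrix is non-negative (`det_tauBlock_nonneg`).
Integration by parts and the limit of vanishing mollification radius give positivity of the current
(`IsPSH.integral_baston_nonneg`).

Closedness is formal: the `∇_{jα}` commute and the `ωʲ` anticommute, so `d₀d₁ = -d₁d₀` and `d_α² =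
0`. This applies to the Baston operator on any current. -/

namespace QPot

/-! ### Extended integrals of functions bounded above -/

/-- The non-negative function `M - f`, for `f ≤ M`. -/
noncomputable def gap {X : Type*} (M : ℝ) (f : X → EReal) (x : X) : ℝ≥0∞ :=
  ((M : EReal) - f x).toENNReal

theorem measurable_gap {X : Type*} [MeasurableSpace X] {f : X → EReal} (hf : Measurable f)
    (M : ℝ) : Measurable (gap M f) :=
  (measurable_const.sub hf).ereal_toENNReal

theorem gap_eq_top_iff {X : Type*} {f : X → EReal} {M : ℝ} {x : X} :
    gap M f x = ⊤ ↔ f x = ⊥ := by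
  unfold gap
  induction f x using EReal.rec with
  | bot => simp
  | top => simp
  | coe r =>
    rw [← EReal.coe_sub, EReal.real_coe_toENNReal]
    simp only [ENNReal.ofReal_ne_top, EReal.coe_ne_bot]

theorem toReal_eq_sub_gap {X : Type*} {f : X → EReal} {M : ℝ} {x : X} (h : f x ≤ M)
    (hb : f x ≠ ⊥) : (f x).toReal = M - (gap M f x).toReal := by
  unfold gap
  induction hx : f x using EReal.rec with
  | bot => exact absurd hx hb
  | top => rw [hx] at h; simp at h
  | coe r =>
    rw [hx, EReal.coe_le_coe_iff] at h
    rw [← EReal.coe_sub, EReal.real_coe_toENNReal, EReal.toReal_coe,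
      ENNReal.toReal_ofReal (by linarith)]
    ring

/-- Both sides are `M + x⁻` in `[0, ∞]`. The identity is arranged without subtraction so that it
survives `x = -∞` and can be integrated termwise. -/
theorem gap_add_toENNReal (x : EReal) {M : ℝ} (hM : 0 ≤ M) (h : x ≤ M) :
    ((M : EReal) - x).toENNReal + x.toENNReal = ENNReal.ofReal M + (-x).toENNReal := by
  induction x using EReal.rec with
  | bot => simp
  | top => simp at h
  | coe r =>
    rw [EReal.coe_le_coe_iff] at h
    rw [← EReal.coe_sub, ← EReal.coe_neg]
    simp only [EReal.real_coe_toENNReal]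
    rcases le_total 0 r with hr | hr
    · rw [ENNReal.ofReal_of_nonpos (p := -r) (by linarith), add_zero,
        ← ENNReal.ofReal_add (by linarith) hr]
      congr 1; ring
    · rw [ENNReal.ofReal_of_nonpos (p := r) hr, add_zero,
        ← ENNReal.ofReal_add hM (by linarith)]
      congr 1

/-- Since `f` is bounded above, a lower bound for its extended integral is an upper bound for the
integral of the non-negative `M - f`. In this form Tonelli applies with no prior integrability of
`f`. -/
theorem lintegral_gap_le_of_le_extIntegral {X : Type*} [MeasurableSpace X] {μ : Measure X}
    [IsProbabilityMeasure μ] {f : X → EReal} (hf : Measurable f) {M : ℝ} (hM : 0 ≤ M)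
    (hfM : ∀ x, f x ≤ M) {c : EReal} (hc : c ≤ extIntegral μ f) :
    ∫⁻ x, gap M f x ∂μ ≤ ((M : EReal) - c).toENNReal := by
  have hsum : ∫⁻ x, gap M f x ∂μ + ∫⁻ x, (f x).toENNReal ∂μ
      = ENNReal.ofReal M + ∫⁻ x, (-f x).toENNReal ∂μ := by
    rw [← lintegral_add_left (measurable_gap hf M)]
    simp only [gap, gap_add_toENNReal _ hM (hfM _)]
    rw [lintegral_add_left measurable_const]
    simp
  have hP : ∫⁻ x, (f x).toENNReal ∂μ ≤ ENNReal.ofReal M := by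
    calc ∫⁻ x, (f x).toENNReal ∂μ ≤ ∫⁻ _, ENNReal.ofReal M ∂μ :=
          lintegral_mono fun x => by
            simpa using EReal.toENNReal_le_toENNReal (hfM x)
      _ = _ := by simp
  unfold extIntegral at hc
  generalize ∫⁻ x, gap M f x ∂μ = G at *
  generalize ∫⁻ x, (f x).toENNReal ∂μ = P at *
  generalize ∫⁻ x, (-f x).toENNReal ∂μ = N at *
  -- The positive part has finite integral, so the subtraction in `extIntegral` is never `⊤ - ⊤`.
  have hPt : P ≠ ⊤ := (hP.trans_lt ENNReal.ofReal_lt_top).ne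
  lift P to NNReal using hPt
  induction c using EReal.rec with
  | bot => simp
  | top =>
    exfalso
    induction N using ENNReal.recTopCoe with
    | top => simp at hc
    | coe N =>
      rw [top_le_iff] at hc
      have : ((P : ℝ≥0∞) : EReal) - ((N : ℝ≥0∞) : EReal) = (((P : ℝ) - N : ℝ) : EReal) := by
        rfl
      rw [this] at hc
      exact EReal.coe_ne_top _ hc
  | coe c =>
    induction N using ENNReal.recTopCoe with
    | top => simp at hc
    | coe N =>
      have : ((P : ℝ≥0∞) : EReal) - ((N : ℝ≥0∞) : EReal) = (((P : ℝ) - N : ℝ) : EReal) := by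
        rfl
      rw [this, EReal.coe_le_coe_iff] at hc
      have hG : G ≠ ⊤ := by
        rintro rfl
        rw [top_add] at hsum
        exact (ENNReal.add_ne_top.2 ⟨ENNReal.ofReal_ne_top, ENNReal.coe_ne_top⟩) hsum.symm
      lift G to NNReal using hG
      rw [← EReal.coe_sub, EReal.real_coe_toENNReal]
      have h2 : (G : ℝ) + P = M + N := by
        have := congrArg ENNReal.toReal hsum
        simpa [ENNReal.toReal_add, hM] using this
      rw [ENNReal.le_ofReal_iff_toReal_le (by simp) (by
        have := G.2
        have h3 : (0 : ℝ) ≤ G := G.2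
        linarith)]
      simp only [ENNReal.coe_toReal]
      linarith

/-- Finiteness of the integral of `M - f` makes `{f = -∞}` a null set, so it does no harm that
`toReal` sends `-∞` to `0`. -/
theorem integrable_toReal_of_lintegral_gap {X : Type*} [MeasurableSpace X] {μ : Measure X}
    [IsFiniteMeasure μ] {f : X → EReal} (hf : Measurable f) {M : ℝ}
    (hfM : ∀ᵐ x ∂μ, f x ≤ M) (h : ∫⁻ x, gap M f x ∂μ ≠ ⊤) :
    (∀ᵐ x ∂μ, f x ≠ ⊥) ∧ Integrable (fun x => (f x).toReal) μ ∧
      ∫ x, (f x).toReal ∂μ = μ.real Set.univ * M - (∫⁻ x, gap M f x ∂μ).toReal := by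
  have hm := measurable_gap hf M
  have h1 : ∀ᵐ x ∂μ, f x ≠ ⊥ := by
    filter_upwards [ae_lt_top hm h] with x hx hx'
    exact hx.ne (gap_eq_top_iff.2 hx')
  have h2 : (fun x => (f x).toReal) =ᵐ[μ] fun x => M - (gap M f x).toReal := by
    filter_upwards [h1, hfM] with x hx hx'
    exact toReal_eq_sub_gap hx' hx
  have h3 : Integrable (fun x => (gap M f x).toReal) μ :=
    integrable_toReal_of_lintegral_ne_top hm.aemeasurable h
  refine ⟨h1, ((integrable_const M).sub h3).congr h2.symm, ?_⟩
  rw [integral_congr_ae h2, integral_sub (integrable_const M) h3,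
    integral_toReal hm.aemeasurable (ae_lt_top hm h)]
  simp

/-! ### The sphere and right multiplications -/

noncomputable instance instIsAddHaarMeasureQuaternion :
    (volume : Measure ℍ[ℝ]).IsAddHaarMeasure :=
  inferInstanceAs (measureSpaceOfInnerProductSpace (E := ℍ[ℝ])).volume.IsAddHaarMeasure

instance instIsProbabilityMeasureSphereProb : IsProbabilityMeasure sphereProb := by
  constructor
  have h0 : (volume : Measure ℍ[ℝ]).toSphere Set.univ ≠ 0 := by
    rw [Measure.measure_univ_ne_zero]
    exact Measure.toSphere_ne_zero _
  rw [sphereProb, Measure.smul_apply, smul_eq_mul,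
    ENNReal.inv_mul_cancel h0 (measure_ne_top _ _)]

theorem measurePreserving_mul_right {t : ℍ[ℝ]} (ht : ‖t‖ = 1) :
    MeasurePreserving (fun x : ℍ[ℝ] => x * t) volume volume := by
  have ht0 : t ≠ 0 := by rintro rfl; simp at ht
  let e : ℍ[ℝ] ≃ₗᵢ[ℝ] ℍ[ℝ] :=
    { toFun := fun x => x * t
      invFun := fun x => x * t⁻¹
      map_add' := fun x y => add_mul x y t
      map_smul' := fun c x => smul_mul_assoc c x t
      left_inv := fun x => mul_inv_cancel_right₀ ht0 x
      right_inv := fun x => inv_mul_cancel_right₀ ht0 x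
      norm_map' := fun x => by
        change ‖x * t‖ = ‖x‖
        rw [norm_mul, ht, mul_one] }
  exact LinearIsometryEquiv.measurePreserving e

open scoped Pointwise in
/-- Right multiplication by a unit quaternion preserves the measure on the sphere. -/
theorem measurePreserving_sphereProb_mul_right (e : Metric.sphere (0 : ℍ[ℝ]) 1) :
    MeasurePreserving (fun ξ : Metric.sphere (0 : ℍ[ℝ]) 1 => ξ * e) sphereProb sphereProb := by
  have hm : Measurable (fun ξ : Metric.sphere (0 : ℍ[ℝ]) 1 => ξ * e) :=
    (continuous_id.mul continuous_const).measurable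
  have he : ‖(e : ℍ[ℝ])‖ = 1 := by simp
  have he0 : (e : ℍ[ℝ]) ≠ 0 := by intro h; simp [h] at he
  suffices h : MeasurePreserving (fun ξ : Metric.sphere (0 : ℍ[ℝ]) 1 => ξ * e)
      (volume : Measure ℍ[ℝ]).toSphere (volume : Measure ℍ[ℝ]).toSphere by
    refine ⟨hm, ?_⟩
    rw [sphereProb, Measure.map_smul, h.map_eq]
  refine ⟨hm, Measure.ext fun s hs => ?_⟩
  rw [Measure.map_apply hm hs, Measure.toSphere_apply' _ (hm hs), Measure.toSphere_apply' _ hs]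
  congr 1
  -- `toSphere` measures a set by the volume of the cone over it, and right multiplication commutes
  -- with forming cones.
  have hpre : Set.Ioo (0 : ℝ) 1 • (Subtype.val '' ((fun ξ => ξ * e) ⁻¹' s))
      = (fun x : ℍ[ℝ] => x * e) ⁻¹' (Set.Ioo (0 : ℝ) 1 • (Subtype.val '' s)) := by
    ext x
    simp only [Set.mem_smul, Set.mem_image, Set.mem_preimage, exists_exists_and_eq_and]
    constructor
    · rintro ⟨r, hr, ξ, hξ, rfl⟩
      exact ⟨r, hr, ξ * e, hξ, by simp⟩
    · rintro ⟨r, hr, ζ, hζ, h⟩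
      refine ⟨r, hr, ζ * e⁻¹, by simpa using hζ, ?_⟩
      have : x = r • ζ * (e : ℍ[ℝ])⁻¹ := by
        rw [h, mul_inv_cancel_right₀ he0]
      rw [this]; simp
  have hme : MeasurableEmbedding (fun x : ℍ[ℝ] => x * (e : ℍ[ℝ])) :=
    (Homeomorph.mulRight₀ (e : ℍ[ℝ]) he0).measurableEmbedding
  rw [hpre, (measurePreserving_mul_right he).measure_preimage_emb hme]

/-- Right multiplication of a vector of `ℍⁿ` by a quaternion, as a real linear map. -/
noncomputable def rmul {n : ℕ} (t : ℍ[ℝ]) : HSpace n →L[ℝ] HSpace n :=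
  ContinuousLinearMap.pi fun l =>
    ((ContinuousLinearMap.mul ℝ ℍ[ℝ]).flip t).comp (ContinuousLinearMap.proj l)

theorem rmul_apply {n : ℕ} (t : ℍ[ℝ]) (v : HSpace n) (l : Fin n) : rmul t v l = v l * t := by
  simp [rmul]

theorem rightLine_eq {n : ℕ} (a v : HSpace n) (t : ℍ[ℝ]) : rightLine a v t = a + rmul t v := by
  ext1 l
  simp [rightLine, rmul_apply]

theorem rmul_one {n : ℕ} (v : HSpace n) : rmul 1 v = v := by
  ext1 l; simp [rmul_apply]

theorem rmul_rmul {n : ℕ} (s t : ℍ[ℝ]) (v : HSpace n) : rmul s (rmul t v) = rmul (t * s) v := by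
  ext1 l; simp [rmul_apply, mul_assoc]

theorem rmul_add {n : ℕ} (s t : ℍ[ℝ]) (v : HSpace n) : rmul (s + t) v = rmul s v + rmul t v := by
  ext1 l; simp [rmul_apply, mul_add]

theorem rmul_smul {n : ℕ} (r : ℝ) (t : ℍ[ℝ]) (v : HSpace n) : rmul (r • t) v = r • rmul t v := by
  ext1 l; simp [rmul_apply]

theorem norm_rmul_le {n : ℕ} (t : ℍ[ℝ]) (v : HSpace n) : ‖rmul t v‖ ≤ ‖v‖ * ‖t‖ := by
  rw [pi_norm_le_iff_of_nonneg (by positivity)]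
  intro l
  rw [rmul_apply, norm_mul]
  gcongr
  exact norm_le_pi_norm v l

theorem measurePreserving_rmul {n : ℕ} {t : ℍ[ℝ]} (ht : ‖t‖ = 1) :
    MeasurePreserving (rmul t : HSpace n → HSpace n) volume volume := by
  have h := volume_preserving_pi (fun _ : Fin n => measurePreserving_mul_right ht)
  have he : (rmul t : HSpace n → HSpace n) = fun v l => v l * t :=
    funext fun v => funext fun l => rmul_apply t v l
  rw [he]
  exact h

/-! ### Sub-mean value properties and local integrability of plurisubharmonic functions -/

/-- Only values on `Ω` matter, because the spheres in the mean value inequality lie in `Ω`. This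
permits redefining `u` as `-∞` outside `Ω`, where it becomes Borel measurable on the whole space. -/
theorem IsPSH.congr {n : ℕ} {Ω : Opens (HSpace n)} {u w : HSpace n → EReal} (hu : IsPSH Ω u)
    (h : ∀ q ∈ Ω, u q = w q) : IsPSH Ω w where
  usc := fun q hq c hc => by
    have := hu.usc q hq c (show u q < c by rw [h q hq]; exact hc)
    filter_upwards [this, self_mem_nhdsWithin] with x hx hx'
    rw [← h x hx']; exact hx
  lt_top := fun q hq => by rw [← h q hq]; exact hu.lt_top q hq
  subharmonic := fun a v hv => by
    have hs := hu.subharmonic a v hv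
    refine ⟨fun t ht c hc => ?_, fun t ht => ?_, fun x r hr hx => ?_⟩
    · have := hs.usc t ht c (show u _ < c by rw [h _ ht]; exact hc)
      filter_upwards [this, self_mem_nhdsWithin] with y hy hy'
      rw [← h _ hy']; exact hy
    · rw [← h _ ht]; exact hs.lt_top t ht
    · have h1 := hs.le_mean x r hr hx
      rw [h _ (hx (Metric.mem_closedBall_self hr.le))] at h1
      refine h1.trans (le_of_eq ?_)
      unfold sphereMean
      congr 1
      ext ξ
      refine h _ (hx ?_)
      have hξ : ‖(ξ : ℍ[ℝ])‖ = 1 := by simp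
      simp [norm_smul, abs_of_pos hr]

open scoped Classical in
/-- A plurisubharmonic function, extended by `-∞`, is Borel measurable. -/
theorem IsPSH.measurable_extend {n : ℕ} {Ω : Opens (HSpace n)} {u : HSpace n → EReal}
    (hu : IsPSH Ω u) : Measurable fun q => if q ∈ Ω then u q else ⊥ := by
  refine measurable_of_Iio fun c => ?_
  rcases eq_or_ne c ⊥ with rfl | hc
  · simp
  have h1 : IsOpen {q | q ∈ Ω ∧ u q < c} := by
    rw [isOpen_iff_mem_nhds]
    rintro q ⟨hq, hqc⟩
    have := hu.usc q hq c hqc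
    rw [Ω.isOpen.nhdsWithin_eq hq] at this
    filter_upwards [this, Ω.isOpen.mem_nhds hq] with x hx hx'
    exact ⟨hx', hx⟩
  have h2 : (fun q => if q ∈ Ω then u q else ⊥) ⁻¹' Set.Iio c
      = {q | q ∈ Ω ∧ u q < c} ∪ (Ω : Set (HSpace n))ᶜ := by
    ext q
    by_cases hq : q ∈ Ω
    · simp [hq]
    · simp [hq, bot_lt_iff_ne_bot.2 hc]
  rw [h2]
  exact h1.measurableSet.union Ω.isOpen.measurableSet.compl

theorem continuous_rmul_sphere {n : ℕ} :
    Continuous fun p : Metric.sphere (0 : ℍ[ℝ]) 1 × HSpace n => rmul (p.1 : ℍ[ℝ]) p.2 := by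
  refine continuous_pi fun l => ?_
  simp only [rmul_apply]
  exact ((continuous_apply l).comp continuous_snd).mul
    (continuous_subtype_val.comp continuous_fst)

theorem continuous_add_rmul {n : ℕ} (a v : HSpace n) : Continuous fun t : ℍ[ℝ] => a + rmul t v := by
  refine continuous_pi fun l => ?_
  simp only [Pi.add_apply, rmul_apply]
  fun_prop

theorem continuous_add_rmul_sphere {n : ℕ} (a v : HSpace n) :
    Continuous fun ξ : Metric.sphere (0 : ℍ[ℝ]) 1 => a + rmul (ξ : ℍ[ℝ]) v :=
  Continuous.comp (g := fun t : ℍ[ℝ] => a + rmul t v) (continuous_add_rmul a v)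
    continuous_subtype_val

theorem measurable_add_rmul_sphere {n : ℕ} (a v : HSpace n) :
    Measurable fun ξ : Metric.sphere (0 : ℍ[ℝ]) 1 => a + rmul (ξ : ℍ[ℝ]) v :=
  (continuous_add_rmul_sphere a v).measurable

/-- The radius is absorbed into `v`, so the unit ball of the parameter suffices. The degenerate
direction `v = 0` is an equality; including it lets `v` range over a full ball. -/
theorem IsPSH.lintegral_gap_sphere_le {n : ℕ} {Ω : Opens (HSpace n)} {u : HSpace n → EReal}
    (hu : IsPSH Ω u) (hm : Measurable u) {a v : HSpace n} {M : ℝ} (hM : 0 ≤ M)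
    (hΩ : ∀ t : ℍ[ℝ], ‖t‖ ≤ 1 → a + rmul t v ∈ Ω)
    (hu_le : ∀ t : ℍ[ℝ], ‖t‖ ≤ 1 → u (a + rmul t v) ≤ M) :
    ∫⁻ ξ, gap M u (a + rmul (ξ : ℍ[ℝ]) v) ∂sphereProb ≤ gap M u a := by
  rcases eq_or_ne v 0 with rfl | hv
  · simp
  have h1 := (hu.subharmonic a v hv).le_mean 0 1 one_pos (fun t ht => by
    rw [Set.mem_ofPred_eq, rightLine_eq]
    exact hΩ t (by simpa using ht))
  have hc := hm.comp (measurable_add_rmul_sphere a v)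
  have h0 : rightLine a v 0 = a := by rw [rightLine_eq]; ext1 l; simp [rmul_apply]
  simp only [sphereMean, h0, zero_add, one_smul, rightLine_eq] at h1
  refine lintegral_gap_le_of_le_extIntegral hc hM (fun ξ => hu_le _ ?_) h1
  simp

theorem norm_rmul_sphere {n : ℕ} (ξ : Metric.sphere (0 : ℍ[ℝ]) 1) (v : HSpace n) :
    ‖rmul (ξ : ℍ[ℝ]) v‖ = ‖v‖ := by
  have hξ : ‖(ξ : ℍ[ℝ])‖ = 1 := by simp
  refine le_antisymm (by simpa using norm_rmul_le (ξ : ℍ[ℝ]) v) ?_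
  have h := norm_rmul_le (ξ : ℍ[ℝ])⁻¹ (rmul (ξ : ℍ[ℝ]) v)
  rw [rmul_rmul, mul_inv_cancel₀ (by intro h; simp [h] at hξ), rmul_one, norm_inv, hξ] at h
  simpa using h

/-- Right multiplication by a unit quaternion preserves both the measure and the ball, so `∫ gap M u
(a + v ξ) dv` does not depend on `ξ`. Averaging over `ξ`, interchanging the integrals and using the
spherical inequality for each `v` gives the bound. -/
theorem IsPSH.lintegral_gap_ball_le {n : ℕ} {Ω : Opens (HSpace n)} {u : HSpace n → EReal}
    (hu : IsPSH Ω u) (hm : Measurable u) {a : HSpace n} {r M : ℝ} (hM : 0 ≤ M)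
    (hΩ : Metric.ball a r ⊆ Ω) (hu_le : ∀ q ∈ Metric.ball a r, u q ≤ M) :
    ∫⁻ q in Metric.ball a r, gap M u q ≤ gap M u a * volume (Metric.ball a r) := by
  have hg : Measurable (gap M u) := measurable_gap hm M
  have htr : ∫⁻ q in Metric.ball a r, gap M u q
      = ∫⁻ v in Metric.ball (0 : HSpace n) r, gap M u (a + v) := by
    have := (measurePreserving_add_left (volume : Measure (HSpace n)) a).setLIntegral_comp_preimage
      (s := Metric.ball a r) measurableSet_ball hg
    rw [← this]
    congr 2
    ext v
    simp
  have hrot : ∀ ξ : Metric.sphere (0 : ℍ[ℝ]) 1,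
      ∫⁻ v in Metric.ball (0 : HSpace n) r, gap M u (a + rmul (ξ : ℍ[ℝ]) v)
        = ∫⁻ q in Metric.ball a r, gap M u q := by
    intro ξ
    have := (measurePreserving_rmul (n := n) (t := (ξ : ℍ[ℝ])) (by simp)).setLIntegral_comp_preimage
      (s := Metric.ball (0 : HSpace n) r) measurableSet_ball (hg.comp (measurable_const_add a))
    rw [htr]
    simp only [Function.comp_def] at this
    rw [← this]
    congr 2
    ext v
    simp [norm_rmul_sphere]
  calc ∫⁻ q in Metric.ball a r, gap M u q
      = ∫⁻ ξ, (∫⁻ v in Metric.ball (0 : HSpace n) r,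
          gap M u (a + rmul (ξ : ℍ[ℝ]) v)) ∂sphereProb := by
        simp only [hrot]; simp
    _ = ∫⁻ v in Metric.ball (0 : HSpace n) r,
          (∫⁻ ξ, gap M u (a + rmul (ξ : ℍ[ℝ]) v) ∂sphereProb) := by
        refine lintegral_lintegral_swap (Measurable.aemeasurable ?_)
        exact hg.comp (continuous_const.add continuous_rmul_sphere).measurable
    _ ≤ ∫⁻ v in Metric.ball (0 : HSpace n) r, gap M u a := by
        refine setLIntegral_mono measurable_const fun v hv => ?_
        have key : ∀ t : ℍ[ℝ], ‖t‖ ≤ 1 → a + rmul t v ∈ Metric.ball a r := by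
          intro t ht
          rw [mem_ball_iff_norm, add_sub_cancel_left]
          rw [mem_ball_zero_iff] at hv
          refine (norm_rmul_le t v).trans_lt (lt_of_le_of_lt ?_ hv)
          exact mul_le_of_le_one_right (norm_nonneg _) ht
        exact hu.lintegral_gap_sphere_le hm hM (fun t ht => hΩ (key t ht))
          fun t ht => hu_le _ (key t ht)
    _ = gap M u a * volume (Metric.ball a r) := by
        rw [setLIntegral_const, Measure.addHaar_ball_center volume a]

theorem IsPSH.exists_le_of_isCompact {n : ℕ} {Ω : Opens (HSpace n)} {u : HSpace n → EReal}
    (hu : IsPSH Ω u) {K : Set (HSpace n)} (hK : IsCompact K) (hKΩ : K ⊆ Ω) :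
    ∃ M : ℝ, 0 ≤ M ∧ ∀ q ∈ K, u q ≤ M := by
  rcases K.eq_empty_or_nonempty with rfl | hne
  · exact ⟨0, le_rfl, by simp⟩
  obtain ⟨q, hq, hmax⟩ := (hu.usc.mono hKΩ).exists_isMaxOn hne hK
  have hlt := hu.lt_top q (hKΩ hq)
  refine ⟨max (u q).toReal 0, le_max_right _ _, fun x hx => (hmax hx).trans ?_⟩
  exact (EReal.le_coe_toReal hlt.ne).trans (EReal.coe_le_coe_iff.2 (le_max_left _ _))

/-- A plurisubharmonic function is integrable on small balls centred at points where it is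
finite. -/
theorem IsPSH.integrableOn_ball {n : ℕ} {Ω : Opens (HSpace n)} {u : HSpace n → EReal}
    (hu : IsPSH Ω u) (hm : Measurable u) {a : HSpace n} {r : ℝ}
    (hΩ : Metric.closedBall a r ⊆ Ω) (ha : u a ≠ ⊥) :
    (∀ᵐ q ∂volume.restrict (Metric.ball a r), u q ≠ ⊥) ∧
      IntegrableOn (fun q => (u q).toReal) (Metric.ball a r) := by
  obtain ⟨M, hM, hle⟩ := hu.exists_le_of_isCompact (isCompact_closedBall a r) hΩ
  have hle' : ∀ q ∈ Metric.ball a r, u q ≤ M := fun q hq => hle q (Metric.ball_subset_closedBall hq)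
  have h1 := hu.lintegral_gap_ball_le hm hM (Metric.ball_subset_closedBall.trans hΩ) hle'
  have : IsFiniteMeasure (volume.restrict (Metric.ball a r)) :=
    ⟨by simpa using measure_ball_lt_top⟩
  have h2 := integrable_toReal_of_lintegral_gap (μ := volume.restrict (Metric.ball a r)) hm
    ((ae_restrict_iff' measurableSet_ball).2 (Filter.Eventually.of_forall hle'))
    (h1.trans_lt (ENNReal.mul_lt_top (lt_top_iff_ne_top.2 (by rwa [Ne, gap_eq_top_iff]))
      measure_ball_lt_top)).ne
  exact ⟨h2.1, h2.2.1⟩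

/-- The set of points with a ball of integrability is open and relatively closed in `Ω`, and it
contains every point of `Ω` where `u` is finite; hence it contains every connected component. -/
theorem IsPSH.exists_integrableOn_ball {n : ℕ} {Ω : Opens (HSpace n)} {u : HSpace n → EReal}
    (hu : IsPSH Ω u) (hm : Measurable u)
    (hfin : ∀ a ∈ Ω, ∃ q ∈ connectedComponentIn (Ω : Set (HSpace n)) a, u q ≠ ⊥)
    {a : HSpace n} (ha : a ∈ Ω) :
    ∃ r > 0, (∀ᵐ q ∂volume.restrict (Metric.ball a r), u q ≠ ⊥) ∧
      IntegrableOn (fun q => (u q).toReal) (Metric.ball a r) := by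
  let P : HSpace n → Prop := fun a => ∃ r > 0, (∀ᵐ q ∂volume.restrict (Metric.ball a r), u q ≠ ⊥) ∧
      IntegrableOn (fun q => (u q).toReal) (Metric.ball a r)
  have hopen' : ∀ {x z : HSpace n} {r : ℝ}, x ∈ Metric.ball z r →
      ((∀ᵐ q ∂volume.restrict (Metric.ball z r), u q ≠ ⊥) ∧
        IntegrableOn (fun q => (u q).toReal) (Metric.ball z r)) → P x := by
    rintro x z r hx ⟨h1, h2⟩
    obtain ⟨ε, hε, hsub⟩ := Metric.isOpen_iff.1 Metric.isOpen_ball x hx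
    exact ⟨ε, hε, ae_restrict_of_ae_restrict_of_subset hsub h1, h2.mono_set hsub⟩
  have hopen : IsOpen {x | P x} := by
    rw [Metric.isOpen_iff]
    rintro x ⟨r, hr, h1, h2⟩
    exact ⟨r, hr, fun y hy => hopen' hy ⟨h1, h2⟩⟩
  have hclosed : ∀ x ∈ Ω, x ∈ closure {x | P x} → P x := by
    intro x hx hcl
    obtain ⟨ε, hε, hsub⟩ := Metric.isOpen_iff.1 Ω.isOpen x hx
    obtain ⟨y, ⟨r, hr, h1, -⟩, hxy⟩ := Metric.mem_closure_iff.1 hcl (ε / 4) (by positivity)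
    -- Almost every point near `y` is a point of finiteness, so one can be taken within `ε / 2` of
    -- `x`. Its ball of radius `ε / 2` then contains `x`, and the closed ball stays in `Ω`.
    obtain ⟨z, hz, hzu⟩ : ∃ z ∈ Metric.ball y (min r (ε / 4)), u z ≠ ⊥ := by
      have h1' := ae_restrict_of_ae_restrict_of_subset
        (Metric.ball_subset_ball (min_le_left r (ε / 4)) : Metric.ball y _ ⊆ _) h1
      rw [ae_restrict_iff' measurableSet_ball] at h1'
      by_contra! hcon
      have h0 : volume (Metric.ball y (min r (ε / 4))) = 0 := by
        refine measure_mono_null (fun z hz => ?_) h1'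
        simp only [Set.mem_compl_iff, Set.mem_ofPred_eq]
        exact fun h => h hz (hcon z hz)
      exact (Metric.measure_ball_pos volume y (lt_min hr (by positivity))).ne' h0
    have hxz : dist x z < ε / 2 := by
      have := Metric.mem_ball.1 hz
      rw [dist_comm] at this
      have h4 := this.trans_le (min_le_right _ _)
      linarith [dist_triangle x y z]
    have h3 := hu.integrableOn_ball hm (a := z) (r := ε / 2) (fun w hw => hsub ?_) hzu
    · exact hopen' (Metric.mem_ball.2 hxz) h3
    · rw [Metric.mem_closedBall] at hw
      rw [Metric.mem_ball]
      rw [dist_comm] at hxz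
      linarith [dist_triangle w z x]
  have hsub : connectedComponentIn (Ω : Set (HSpace n)) a ⊆ {x | P x} := by
    refine isPreconnected_connectedComponentIn.subset_of_closure_inter_subset hopen ?_
      fun x hx => hclosed x (connectedComponentIn_subset _ _ hx.2) hx.1
    obtain ⟨q, hq, hqu⟩ := hfin a ha
    refine ⟨q, hq, ?_⟩
    obtain ⟨ε, hε, hsub⟩ := Metric.nhds_basis_closedBall.mem_iff.1
      (Ω.isOpen.mem_nhds (connectedComponentIn_subset _ _ hq))
    exact ⟨ε, hε, hu.integrableOn_ball hm hsub hqu⟩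
  exact hsub (mem_connectedComponentIn ha)

theorem IsPSH.locallyIntegrableOn {n : ℕ} {Ω : Opens (HSpace n)} {u : HSpace n → EReal}
    (hu : IsPSH Ω u) (hm : Measurable u)
    (hfin : ∀ a ∈ Ω, ∃ q ∈ connectedComponentIn (Ω : Set (HSpace n)) a, u q ≠ ⊥) :
    LocallyIntegrableOn (fun q => (u q).toReal) (Ω : Set (HSpace n)) := by
  intro a ha
  obtain ⟨r, hr, -, h⟩ := hu.exists_integrableOn_ball hm hfin ha
  exact ⟨Metric.ball a r, mem_nhdsWithin_of_mem_nhds (Metric.ball_mem_nhds a hr), h⟩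

theorem IsPSH.ae_ne_bot {n : ℕ} {Ω : Opens (HSpace n)} {u : HSpace n → EReal}
    (hu : IsPSH Ω u) (hm : Measurable u)
    (hfin : ∀ a ∈ Ω, ∃ q ∈ connectedComponentIn (Ω : Set (HSpace n)) a, u q ≠ ⊥) :
    ∀ᵐ q ∂volume.restrict (Ω : Set (HSpace n)), u q ≠ ⊥ := by
  rw [ae_restrict_iff' Ω.isOpen.measurableSet, ae_iff]
  refine measure_null_of_locally_null _ fun a ha => ?_
  simp only [Set.mem_ofPred_eq, Classical.not_imp] at ha
  obtain ⟨r, hr, h, -⟩ := hu.exists_integrableOn_ball hm hfin ha.1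
  rw [ae_restrict_iff' measurableSet_ball, ae_iff] at h
  refine ⟨_, inter_mem_nhdsWithin _ (Metric.ball_mem_nhds a hr), measure_mono_null ?_ h⟩
  rintro x ⟨hx, hx'⟩
  simp only [Set.mem_ofPred_eq, Classical.not_imp] at hx ⊢
  exact ⟨hx', hx.2⟩

/-! ### The second order test for the sub-mean value property -/

/-- Second order Taylor expansion with Peano remainder. -/
theorem taylor_two_isLittleO {E : Type*} [NormedAddCommGroup E] [NormedSpace ℝ E] {g : E → ℝ}
    {x : E} (hg : ContDiffAt ℝ 2 g x) :
    (fun h => g (x + h) - g x - fderiv ℝ g x h - 2⁻¹ * fderiv ℝ (fderiv ℝ g) x h h)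
      =o[nhds 0] fun h => ‖h‖ ^ 2 := by
  set B := fderiv ℝ (fderiv ℝ g) x with hB
  have hsym : ∀ v w, B v w = B w v := hg.isSymmSndFDerivAt (by simp)
  have hd : ∀ᶠ y in nhds x, DifferentiableAt ℝ g y := by
    filter_upwards [hg.eventually (by simp)] with y hy
    exact hy.differentiableAt (by simp)
  have hdd : HasFDerivAt (fderiv ℝ g) B x :=
    ((hg.fderiv_right (m := 1) (by norm_num)).differentiableAt (by simp)).hasFDerivAt
  rw [Asymptotics.isLittleO_iff]
  intro ε hε
  have h1 := (Asymptotics.isLittleO_iff.1 (hasFDerivAt_iff_isLittleO_nhds_zero.1 hdd)) hε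
  have h2 : ∀ᶠ h in nhds (0 : E), DifferentiableAt ℝ g (x + h) := by
    have : Filter.Tendsto (fun h => x + h) (nhds 0) (nhds x) := by
      simpa using (continuous_const_add x).tendsto 0
    exact this.eventually hd
  obtain ⟨δ, hδ, hball⟩ := Metric.eventually_nhds_iff_ball.1 (h1.and h2)
  rw [Metric.eventually_nhds_iff_ball]
  refine ⟨δ, hδ, fun h hh => ?_⟩
  let f : E → ℝ := fun h => g (x + h) - g x - fderiv ℝ g x h - 2⁻¹ * B h h
  -- Symmetry of `B` makes the derivative of `2⁻¹ * B h h` equal to `B k`. The remainder thus has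
  -- derivative `o(‖k‖)`, and the mean value inequality on the ball of radius `‖h‖` gives `o(‖h‖ ^
  -- 2)`.
  have hf : ∀ k ∈ Metric.ball (0 : E) δ,
      HasFDerivAt f (fderiv ℝ g (x + k) - fderiv ℝ g x - B k) k := by
    intro k hk
    have e1 : HasFDerivAt (fun h => g (x + h)) (fderiv ℝ g (x + k)) k :=
      (hasFDerivAt_comp_add_left x).2 (hball k hk).2.hasFDerivAt
    have e2 : HasFDerivAt (fun h => B h h) (B k + B.flip k) k := by
      have := B.hasFDerivAt_of_bilinear (hasFDerivAt_id k) (hasFDerivAt_id k)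
      refine this.congr_fderiv ?_
      ext w
      simp [ContinuousLinearMap.precompR, ContinuousLinearMap.precompL]
    have e3 := ((e1.sub_const (g x)).sub (fderiv ℝ g x).hasFDerivAt).sub (e2.const_mul (2⁻¹ : ℝ))
    refine e3.congr_fderiv ?_
    ext w
    simp [hsym w k]
    ring
  have hk : ∀ k ∈ Metric.closedBall (0 : E) ‖h‖,
      ‖fderiv ℝ g (x + k) - fderiv ℝ g x - B k‖ ≤ ε * ‖h‖ := by
    intro k hk
    rw [mem_closedBall_zero_iff] at hk
    rw [mem_ball_zero_iff] at hh
    refine ((hball k (mem_ball_zero_iff.2 (hk.trans_lt hh))).1).trans ?_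
    gcongr
  have := (convex_closedBall (0 : E) ‖h‖).norm_image_sub_le_of_norm_hasFDerivWithin_le
    (f := f) (x := 0) (y := h) (fun k hk => (hf k ?_).hasFDerivWithinAt) hk
    (by simp) (by simp)
  · have hf0 : f 0 = 0 := by simp [f]
    rw [hf0, sub_zero, sub_zero] at this
    refine this.trans (le_of_eq ?_)
    rw [Real.norm_of_nonneg (by positivity)]
    ring
  · rw [mem_closedBall_zero_iff] at hk
    rw [mem_ball_zero_iff] at hh ⊢
    exact hk.trans_lt hh

/-- `1`, `𝐢`, `𝐣`, `𝐤`. -/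
def unitQ : Fin 4 → ℍ[ℝ] := ![1, unitI, unitJ, unitK]

theorem unitI_components : unitI.re = 0 ∧ unitI.imI = 1 ∧ unitI.imJ = 0 ∧ unitI.imK = 0 :=
  ⟨rfl, rfl, rfl, rfl⟩

theorem unitJ_components : unitJ.re = 0 ∧ unitJ.imI = 0 ∧ unitJ.imJ = 1 ∧ unitJ.imK = 0 :=
  ⟨rfl, rfl, rfl, rfl⟩

theorem unitK_components : unitK.re = 0 ∧ unitK.imI = 0 ∧ unitK.imJ = 0 ∧ unitK.imK = 1 :=
  ⟨rfl, rfl, rfl, rfl⟩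

theorem norm_unitQ (e : Fin 4) : ‖unitQ e‖ = 1 := by
  have h : ‖unitQ e‖ ^ 2 = 1 := by
    rw [sq, ← Quaternion.normSq_eq_norm_mul_self, Quaternion.normSq_def']
    fin_cases e <;> simp [unitQ, unitI, unitJ, unitK]
  exact (pow_eq_one_iff_of_nonneg (norm_nonneg _) two_ne_zero).1 h

theorem quaternion_eq_sum (x : ℍ[ℝ]) :
    x = x.re • (1 : ℍ[ℝ]) + x.imI • unitI + x.imJ • unitJ + x.imK • unitK := by
  ext <;> simp [unitI_components, unitJ_components, unitK_components]

/-- The vectors `x, x𝐢, x𝐣, x𝐤` are orthogonal of length `‖x‖`, and the trace does not depend on the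
orthonormal frame. -/
theorem sum_bilin_mul_unitQ (C : ℍ[ℝ] →ₗ[ℝ] ℍ[ℝ] →ₗ[ℝ] ℝ) (x : ℍ[ℝ]) :
    ∑ e, C (x * unitQ e) (x * unitQ e) = ‖x‖ ^ 2 * ∑ e, C (unitQ e) (unitQ e) := by
  have h1 : x * unitI =
      (-x.imI) • (1 : ℍ[ℝ]) + x.re • unitI + x.imK • unitJ + (-x.imJ) • unitK := by
    ext <;> simp [unitI_components, unitJ_components, unitK_components]
  have h2 : x * unitJ =
      (-x.imJ) • (1 : ℍ[ℝ]) + (-x.imK) • unitI + x.re • unitJ + x.imI • unitK := by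
    ext <;> simp [unitI_components, unitJ_components, unitK_components]
  have h3 : x * unitK =
      (-x.imK) • (1 : ℍ[ℝ]) + x.imJ • unitI + (-x.imI) • unitJ + x.re • unitK := by
    ext <;> simp [unitI_components, unitJ_components, unitK_components]
  have hn : ‖x‖ ^ 2 = x.re ^ 2 + x.imI ^ 2 + x.imJ ^ 2 + x.imK ^ 2 := by
    rw [sq, ← Quaternion.normSq_eq_norm_mul_self, Quaternion.normSq_def']
  have h0 := quaternion_eq_sum x
  simp only [Fin.sum_univ_four, unitQ, Matrix.cons_val, mul_one]
  rw [h1, h2, h3, hn]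
  nth_rw 1 2 [h0]
  simp only [map_add, map_smul, LinearMap.add_apply, LinearMap.smul_apply, smul_eq_mul]
  ring

/-- The antipodal map is right multiplication by `-1`, hence measure preserving, and it changes the
sign of `f`. -/
theorem integral_sphereProb_linear (f : ℍ[ℝ] →L[ℝ] ℝ) :
    ∫ ξ : Metric.sphere (0 : ℍ[ℝ]) 1, f ξ ∂sphereProb = 0 := by
  let s : Metric.sphere (0 : ℍ[ℝ]) 1 := ⟨-1, by simp⟩
  have h : ∫ ξ : Metric.sphere (0 : ℍ[ℝ]) 1, f (ξ * -1) ∂sphereProb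
      = ∫ ξ : Metric.sphere (0 : ℍ[ℝ]) 1, f ξ ∂sphereProb :=
    (measurePreserving_sphereProb_mul_right s).integral_comp
      (Homeomorph.mulRight s).measurableEmbedding (fun ξ => f (ξ : ℍ[ℝ]))
  simp only [mul_neg, mul_one, map_neg, integral_neg] at h
  linarith

theorem integrable_sphereProb {f : Metric.sphere (0 : ℍ[ℝ]) 1 → ℝ} (hf : Continuous f) :
    Integrable f sphereProb :=
  hf.integrable_of_hasCompactSupport (HasCompactSupport.of_compactSpace f)

/-- The four rotations by `1, 𝐢, 𝐣, 𝐤` leave the integral unchanged, and the sum of the four rotated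
integrands is constant on the sphere, equal to the trace. -/
theorem integral_sphereProb_bilinear (C : ℍ[ℝ] →L[ℝ] ℍ[ℝ] →L[ℝ] ℝ) :
    ∫ ξ : Metric.sphere (0 : ℍ[ℝ]) 1, C ξ ξ ∂sphereProb
      = 4⁻¹ * ∑ e, C (unitQ e) (unitQ e) := by
  have h : ∀ e, ∫ ξ : Metric.sphere (0 : ℍ[ℝ]) 1, C (ξ * unitQ e) (ξ * unitQ e) ∂sphereProb
      = ∫ ξ : Metric.sphere (0 : ℍ[ℝ]) 1, C ξ ξ ∂sphereProb := fun e => by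
    let s : Metric.sphere (0 : ℍ[ℝ]) 1 := ⟨unitQ e, by simp [norm_unitQ]⟩
    exact (measurePreserving_sphereProb_mul_right s).integral_comp
      (Homeomorph.mulRight s).measurableEmbedding (fun ξ => C (ξ : ℍ[ℝ]) (ξ : ℍ[ℝ]))
  have hsum : ∑ e, ∫ ξ : Metric.sphere (0 : ℍ[ℝ]) 1, C (ξ * unitQ e) (ξ * unitQ e) ∂sphereProb
      = ∑ e, C (unitQ e) (unitQ e) := by
    rw [← integral_finsetSum _ fun e _ => integrable_sphereProb (by fun_prop)]
    have : ∀ ξ : Metric.sphere (0 : ℍ[ℝ]) 1, ∑ e, C (ξ * unitQ e) (ξ * unitQ e)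
        = ∑ e, C (unitQ e) (unitQ e) := fun ξ => by
      have h1 := sum_bilin_mul_unitQ
        (LinearMap.mk₂ ℝ (fun s t => C s t) (by simp) (by simp) (by simp) (by simp)) ξ
      simpa using h1
    simp only [this]
    simp
  simp only [h] at hsum
  rw [← hsum]
  simp

/-- With `S` the sum in question, the mean over the sphere of radius `r` is `g x + r² S / 8 +
o(r²)`: one half from Taylor's formula, one quarter from the spherical average. A negative `S` would
contradict the mean value inequality for small `r`. -/
theorem sum_sndFDeriv_nonneg {n : ℕ} {g : HSpace n → ℝ} {x v : HSpace n}
    (hg : ContDiffAt ℝ 2 g x)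
    (hmean : ∀ᶠ r : ℝ in nhdsWithin 0 (Set.Ioi 0),
      g x ≤ ∫ ξ : Metric.sphere (0 : ℍ[ℝ]) 1, g (x + r • rmul (ξ : ℍ[ℝ]) v) ∂sphereProb) :
    0 ≤ ∑ e, fderiv ℝ (fderiv ℝ g) x (rmul (unitQ e) v) (rmul (unitQ e) v) := by
  set B := fderiv ℝ (fderiv ℝ g) x with hB
  let T : ℍ[ℝ] →L[ℝ] HSpace n := LinearMap.toContinuousLinearMap
    { toFun := fun t => rmul t v
      map_add' := fun s t => rmul_add s t v
      map_smul' := fun r t => rmul_smul r t v }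
  have hT : ∀ t, T t = rmul t v := fun t => rfl
  set C : ℍ[ℝ] →L[ℝ] ℍ[ℝ] →L[ℝ] ℝ := B.bilinearComp T T with hC
  set S := ∑ e, B (rmul (unitQ e) v) (rmul (unitQ e) v) with hS
  have hCS : ∫ ξ : Metric.sphere (0 : ℍ[ℝ]) 1, C ξ ξ ∂sphereProb = 4⁻¹ * S :=
    integral_sphereProb_bilinear C
  by_contra! hneg
  -- The Taylor error `ε r² ‖v‖²` must stay below the deficit `-r² S / 8`. The `+ 1` in the
  -- denominator covers a vanishing `‖v‖`.
  obtain ⟨ε, hε, hε2⟩ : ∃ ε > 0, ε * ‖v‖ ^ 2 < - (8⁻¹ * S) := by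
    refine ⟨- (8⁻¹ * S) / (‖v‖ ^ 2 + 1), div_pos (by linarith) (by positivity), ?_⟩
    rw [div_mul_eq_mul_div, div_lt_iff₀ (by positivity)]
    nlinarith [sq_nonneg ‖v‖]
  have htay := Asymptotics.isLittleO_iff.1 (taylor_two_isLittleO hg) hε
  have hcont : ∀ᶠ h in nhds (0 : HSpace n), ContinuousAt g (x + h) := by
    have h1 : ∀ᶠ y in nhds x, ContinuousAt g y := by
      filter_upwards [hg.eventually (by simp)] with y hy using hy.continuousAt
    have : Filter.Tendsto (fun h => x + h) (nhds 0) (nhds x) := by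
      simpa using (continuous_const_add x).tendsto 0
    exact this.eventually h1
  obtain ⟨δ, hδ, hball⟩ := Metric.eventually_nhds_iff_ball.1 (htay.and hcont)
  have hsmall : ∀ᶠ r : ℝ in nhdsWithin 0 (Set.Ioi 0), r * ‖v‖ < δ := by
    have : Filter.Tendsto (fun r : ℝ => r * ‖v‖) (nhds 0) (nhds 0) := by
      simpa using (continuous_mul_const ‖v‖).tendsto (0 : ℝ)
    exact nhdsWithin_le_nhds (this.eventually (gt_mem_nhds hδ))
  obtain ⟨r, hr1, hr2, hr0⟩ := (hmean.and (hsmall.and self_mem_nhdsWithin)).exists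
  replace hr0 : 0 < r := hr0
  have hnorm : ∀ ξ : Metric.sphere (0 : ℍ[ℝ]) 1, ‖r • rmul (ξ : ℍ[ℝ]) v‖ = r * ‖v‖ := fun ξ => by
    rw [norm_smul, norm_rmul_sphere, Real.norm_of_nonneg hr0.le]
  have hmem : ∀ ξ : Metric.sphere (0 : ℍ[ℝ]) 1,
      r • rmul (ξ : ℍ[ℝ]) v ∈ Metric.ball (0 : HSpace n) δ := fun ξ => by
    rw [mem_ball_zero_iff, hnorm]; exact hr2
  have hTc : Continuous fun ξ : Metric.sphere (0 : ℍ[ℝ]) 1 => T ξ :=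
    T.continuous.comp continuous_subtype_val
  have hfc : Continuous fun ξ : Metric.sphere (0 : ℍ[ℝ]) 1 => g (x + r • rmul (ξ : ℍ[ℝ]) v) := by
    rw [continuous_iff_continuousAt]
    intro ξ
    exact ((hball _ (hmem ξ)).2).comp (f := fun ξ : Metric.sphere (0 : ℍ[ℝ]) 1 => x + r • T ξ)
      (continuous_const.add (hTc.const_smul r)).continuousAt
  have hpt : ∀ ξ : Metric.sphere (0 : ℍ[ℝ]) 1, g (x + r • rmul (ξ : ℍ[ℝ]) v)
      ≤ g x + r * (fderiv ℝ g x ∘L T) ξ + r ^ 2 * 2⁻¹ * C ξ ξ + ε * r ^ 2 * ‖v‖ ^ 2 := by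
    intro ξ
    have h1 := (hball _ (hmem ξ)).1
    rw [Real.norm_of_nonneg (by positivity : (0 : ℝ) ≤ ‖r • rmul (ξ : ℍ[ℝ]) v‖ ^ 2), hnorm] at h1
    have h2 := (abs_le.1 h1).2
    simp only [map_smul, smul_eq_mul, smul_apply] at h2
    simp only [ContinuousLinearMap.comp_apply, hT, hC, ContinuousLinearMap.bilinearComp_apply]
    linarith
  have hint := integral_mono (integrable_sphereProb hfc)
    (integrable_sphereProb (by fun_prop)) hpt
  rw [integral_add (integrable_sphereProb (by fun_prop)) (integrable_sphereProb (by fun_prop)),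
    integral_add (integrable_sphereProb (by fun_prop)) (integrable_sphereProb (by fun_prop)),
    integral_add (integrable_sphereProb (by fun_prop)) (integrable_sphereProb (by fun_prop)),
    integral_const_mul, integral_const_mul, integral_sphereProb_linear, hCS] at hint
  simp only [integral_const, probReal_univ, one_smul] at hint
  have : 0 < r ^ 2 := by positivity
  nlinarith

/-! ### The Baston element of a real bilinear form -/

/-- `B_ℂ(D_{jα}, D_{kβ})` for the complex vectors `D_{jα} = dirRe j α + i dirIm j α`. -/
noncomputable def nablaCoeff {n : ℕ} (B : LinearMap.BilinForm ℝ (HSpace n)) (α β : Fin 2)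
    (j k : Fin (2 * n)) : ℂ :=
  ((B (dirRe j α) (dirRe k β) - B (dirIm j α) (dirIm k β) : ℝ) : ℂ) +
    Complex.I * ((B (dirRe j α) (dirIm k β) + B (dirIm j α) (dirRe k β) : ℝ) : ℂ)

/-- The value of the Baston operator on a function with second derivative `B`. -/
noncomputable def baston {n : ℕ} (B : LinearMap.BilinForm ℝ (HSpace n)) : Ext n :=
  ∑ j, ∑ k, nablaCoeff B 0 1 j k • (omega j * omega k)

theorem bilinForm_smul_apply {V : Type*} [AddCommGroup V] [Module ℝ V] (c : ℝ)
    (B : LinearMap.BilinForm ℝ V) (v w : V) : (c • B) v w = c * B v w := rfl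

theorem nablaCoeff_sum {n : ℕ} {ι : Type*} (s : Finset ι) (c : ι → ℝ)
    (B : ι → LinearMap.BilinForm ℝ (HSpace n)) (α β : Fin 2) (j k : Fin (2 * n)) :
    nablaCoeff (∑ i ∈ s, c i • B i) α β j k = ∑ i ∈ s, (c i : ℂ) * nablaCoeff (B i) α β j k := by
  simp only [nablaCoeff, LinearMap.coe_sum, Finset.sum_apply, bilinForm_smul_apply,
    mul_add, Finset.sum_add_distrib, Complex.ofReal_add, Complex.ofReal_sub,
    Complex.ofReal_sum, Complex.ofReal_mul, mul_sub, Finset.sum_sub_distrib, Finset.mul_sum,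
    mul_left_comm Complex.I]

theorem baston_sum {n : ℕ} {ι : Type*} (s : Finset ι) (c : ι → ℝ)
    (B : ι → LinearMap.BilinForm ℝ (HSpace n)) :
    baston (∑ i ∈ s, c i • B i) = ∑ i ∈ s, (c i : ℂ) • baston (B i) := by
  simp only [baston, nablaCoeff_sum, Finset.sum_smul, Finset.smul_sum, mul_smul]
  rw [Finset.sum_comm (s := s)]
  refine Finset.sum_congr rfl fun j _ => ?_
  rw [Finset.sum_comm (s := s)]

theorem omega_mul_omega_comm {n : ℕ} (j k : Fin (2 * n)) :
    (omega j * omega k : Ext n) = -(omega k * omega j) :=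
  eq_neg_of_add_eq_zero_left (ExteriorAlgebra.ι_add_mul_swap _ _)

theorem ι_eq_sum_omega {n : ℕ} (x : CSpace n) :
    ExteriorAlgebra.ι ℂ x = ∑ j, x j • (omega j : Ext n) := by
  conv_lhs => rw [pi_eq_sum_univ' x]
  simp only [map_sum, map_smul, omega]

/-- The right linear map `q ↦ ∑ a_l q_l`. -/
noncomputable def rightLinOf {n : ℕ} (a : Fin n → ℍ[ℝ]) : RightLin n where
  toFun q := ∑ l, a l * q l
  map_add' p q := by simp [mul_add, Finset.sum_add_distrib]
  map_smul' c q := by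
    simp [Finset.sum_mul, mul_assoc]

theorem rightLinOf_single {n : ℕ} (a : Fin n → ℍ[ℝ]) (l : Fin n) :
    rightLinOf a (Pi.single l 1) = a l := by
  simp [rightLinOf, Pi.single_apply]

/-- The right linear map whose real part is the real linear form `f`. -/
noncomputable def rightLinOfReal {n : ℕ} (f : HSpace n →ₗ[ℝ] ℝ) : RightLin n :=
  -- The minus signs come from `Re (a x) = a₀x₀ - a₁x₁ - a₂x₂ - a₃x₃`.
  rightLinOf fun l => (⟨f (Pi.single l 1), -f (Pi.single l unitI), -f (Pi.single l unitJ),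
    -f (Pi.single l unitK)⟩ : ℍ[ℝ])

/-- This is where the conventions for `τ` and `∇_{jα}` fit together: the entries of `τ(η)` are the
values of the complexified real part of `η` on the complex directions defining `∇_{jα}`. -/
theorem tau_rightLinOfReal {n : ℕ} (f : HSpace n →ₗ[ℝ] ℝ) (j : Fin (2 * n)) (α : Fin 2) :
    tau (rightLinOfReal f (Pi.single (blk j) 1)) α (par j)
      = f (dirRe j α) + Complex.I * f (dirIm j α) := by
  have h : rightLinOfReal f (Pi.single (blk j) 1) = (⟨f (Pi.single (blk j) 1),
      -f (Pi.single (blk j) unitI), -f (Pi.single (blk j) unitJ),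
      -f (Pi.single (blk j) unitK)⟩ : ℍ[ℝ]) := rightLinOf_single _ _
  rw [h]
  unfold dirRe dirIm
  generalize blk j = l
  generalize par j = ε
  fin_cases α <;> fin_cases ε <;> simp [tau, nablaDir, Pi.single_neg]

/-- For a square, the coefficient of `ωʲ ∧ ωᵏ` is a product of a factor depending on `j` and one
depending on `k`, so the double sum splits into a wedge product. -/
theorem baston_mul_self {n : ℕ} (f : HSpace n →ₗ[ℝ] ℝ) :
    baston (LinearMap.BilinForm.linMulLin f f)
      = pullback (rightLinOfReal f) 0 * pullback (rightLinOfReal f) 1 := by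
  unfold pullback baston
  rw [ι_eq_sum_omega, ι_eq_sum_omega, Finset.sum_mul_sum]
  refine Finset.sum_congr rfl fun j _ => Finset.sum_congr rfl fun k _ => ?_
  rw [tau_rightLinOfReal, tau_rightLinOfReal, smul_mul_smul_comm]
  congr 1
  simp only [nablaCoeff, LinearMap.BilinForm.linMulLin_apply]
  push_cast
  linear_combination (f (dirIm j 0) * f (dirIm k 1) : ℂ) * (-Complex.I_mul_I)

/-- The form `(v, w) ↦ B(v e, w e)`. -/
noncomputable def rotForm {n : ℕ} (B : LinearMap.BilinForm ℝ (HSpace n)) (e : ℍ[ℝ]) :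
    LinearMap.BilinForm ℝ (HSpace n) :=
  B.compl₁₂ (rmul e : HSpace n →L[ℝ] HSpace n).toLinearMap
    (rmul e : HSpace n →L[ℝ] HSpace n).toLinearMap

theorem rotForm_apply {n : ℕ} (B : LinearMap.BilinForm ℝ (HSpace n)) (e : ℍ[ℝ]) (v w : HSpace n) :
    rotForm B e v w = B (rmul e v) (rmul e w) := rfl

theorem rmul_single {n : ℕ} (e x : ℍ[ℝ]) (l : Fin n) :
    rmul e (Pi.single l x : HSpace n) = Pi.single l (x * e) := by
  ext1 i
  rw [rmul_apply]
  by_cases h : i = l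
  · subst h; simp
  · simp [h]

theorem units_mul_table : unitI * unitI = -1 ∧ unitI * unitJ = unitK ∧ unitI * unitK = -unitJ ∧
    unitJ * unitI = -unitK ∧ unitJ * unitJ = -1 ∧ unitJ * unitK = unitI ∧
    unitK * unitI = unitJ ∧ unitK * unitJ = -unitI ∧ unitK * unitK = -1 := by
  refine ⟨?_, ?_, ?_, ?_, ?_, ?_, ?_, ?_, ?_⟩ <;> ext <;>
    simp [unitI_components, unitJ_components, unitK_components]

/-- On `D_{jα} = dirRe j α + i dirIm j α`, right multiplication by `𝐢` is the scalar `-i` for `α =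
0` and `i` for `α = 1`. The scalars cancel in `B(D_{j0}, D_{k1})`. -/
theorem rmul_unitI_dir {n : ℕ} (j : Fin (2 * n)) :
    rmul unitI (dirRe j 0) = dirIm j 0 ∧ rmul unitI (dirIm j 0) = -dirRe j 0 ∧
      rmul unitI (dirRe j 1) = -dirIm j 1 ∧ rmul unitI (dirIm j 1) = dirRe j 1 := by
  simp only [dirRe, dirIm, rmul_single]
  generalize blk j = l
  generalize par j = ε
  fin_cases ε <;> simp [nablaDir, Pi.single_neg, units_mul_table]

/-- Right multiplication by `𝐣` sends `D_{j0}` to `-D_{j1}` and `D_{j1}` to `D_{j0}`. In the Baston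
element, the resulting sign and exchange of arguments are undone by symmetry of `B` and antisymmetry
of `ωʲ ∧ ωᵏ`. -/
theorem rmul_unitJ_dir {n : ℕ} (j : Fin (2 * n)) :
    rmul unitJ (dirRe j 0) = -dirRe j 1 ∧ rmul unitJ (dirIm j 0) = -dirIm j 1 ∧
      rmul unitJ (dirRe j 1) = dirRe j 0 ∧ rmul unitJ (dirIm j 1) = dirIm j 0 := by
  simp only [dirRe, dirIm, rmul_single]
  generalize blk j = l
  generalize par j = ε
  fin_cases ε <;> simp [nablaDir, Pi.single_neg, units_mul_table]

theorem rotForm_symm {n : ℕ} {B : LinearMap.BilinForm ℝ (HSpace n)} (hB : ∀ v w, B v w = B w v)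
    (e : ℍ[ℝ]) (v w : HSpace n) : rotForm B e v w = rotForm B e w v := by
  simp only [rotForm_apply]; exact hB _ _

theorem baston_rotForm_unitI {n : ℕ} (B : LinearMap.BilinForm ℝ (HSpace n)) :
    baston (rotForm B unitI) = baston B := by
  unfold baston
  refine Finset.sum_congr rfl fun j _ => Finset.sum_congr rfl fun k _ => ?_
  congr 1
  simp only [nablaCoeff, rotForm_apply, rmul_unitI_dir, map_neg, LinearMap.neg_apply]
  push_cast
  ring

theorem baston_rotForm_unitJ {n : ℕ} {B : LinearMap.BilinForm ℝ (HSpace n)}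
    (hB : ∀ v w, B v w = B w v) : baston (rotForm B unitJ) = baston B := by
  unfold baston
  rw [Finset.sum_comm]
  refine Finset.sum_congr rfl fun j _ => Finset.sum_congr rfl fun k _ => ?_
  rw [omega_mul_omega_comm k j, smul_neg, ← neg_smul]
  congr 1
  simp only [nablaCoeff, rotForm_apply, rmul_unitJ_dir, map_neg, LinearMap.neg_apply]
  rw [hB (dirRe k 1), hB (dirRe k 1), hB (dirIm k 1), hB (dirIm k 1)]
  push_cast
  ring

theorem baston_rotForm_unitQ {n : ℕ} {B : LinearMap.BilinForm ℝ (HSpace n)}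
    (hB : ∀ v w, B v w = B w v) (e : Fin 4) : baston (rotForm B (unitQ e)) = baston B := by
  have h1 : rotForm B 1 = B := by
    refine LinearMap.ext₂ fun v w => ?_
    rw [rotForm_apply, rmul_one, rmul_one]
  have hk : rotForm B unitK = rotForm (rotForm B unitJ) unitI := by
    refine LinearMap.ext₂ fun v w => ?_
    simp only [rotForm_apply, rmul_rmul, units_mul_table]
  fin_cases e
  · simp [unitQ, h1]
  · exact baston_rotForm_unitI B
  · exact baston_rotForm_unitJ hB
  · change baston (rotForm B unitK) = _
    rw [hk, baston_rotForm_unitI, baston_rotForm_unitJ hB]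

theorem isElementaryStronglyPositive_one {n : ℕ} {η : RightLin n} (hη : η ≠ 0) :
    IsElementaryStronglyPositive 1 (pullback η 0 * pullback η 1) := by
  refine ⟨fun _ => η, ?_, by simp⟩
  rw [linearIndependent_unique_iff]
  exact hη

theorem rightLin_nontrivial {n : ℕ} (hn : 1 ≤ n) : ∃ η : RightLin n, η ≠ 0 := by
  refine ⟨rightLinOf fun _ => 1, fun h => ?_⟩
  have := rightLinOf_single (fun _ : Fin n => (1 : ℍ[ℝ])) ⟨0, hn⟩
  rw [h] at this
  simp at this

/-- Elementary elements require `η ≠ 0`. A vanishing `η i` contributes zero, so it is exchanged for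
a fixed non-zero map with coefficient `0`; such a map exists because `n ≥ 1`. -/
theorem isStronglyPositive_one_sum {n : ℕ} (hn : 1 ≤ n) {m : ℕ} {c : Fin m → ℝ}
    (hc : ∀ i, 0 ≤ c i) (η : Fin m → RightLin n) :
    IsStronglyPositive 1 (∑ i, (c i : ℂ) • (pullback (η i) 0 * pullback (η i) 1)) := by
  classical
  obtain ⟨η₀, h₀⟩ := rightLin_nontrivial hn
  let η' : Fin m → RightLin n := fun i => if η i = 0 then η₀ else η i
  have hη' : ∀ i, η' i ≠ 0 := fun i => by
    by_cases h : η i = 0 <;> simp [η', h, h₀]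
  refine ⟨m, fun i => if η i = 0 then 0 else c i, fun i => pullback (η' i) 0 * pullback (η' i) 1,
    fun i => ?_, fun i => isElementaryStronglyPositive_one (hη' i), ?_⟩
  · dsimp only; split_ifs
    exacts [le_rfl, hc i]
  · refine Finset.sum_congr rfl fun i _ => ?_
    by_cases h : η i = 0
    · have : pullback (0 : RightLin n) 0 = 0 := by
        unfold pullback
        convert map_zero (ExteriorAlgebra.ι ℂ (M := CSpace n)) using 2
        ext j
        generalize par j = ε
        fin_cases ε <;> simp [tau]
      simp [h, this]
    · simp [h, η']

/-- If the average of `B` over right multiplications by `1, 𝐢, 𝐣, 𝐤` is positive semidefinite, the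
Baston element of `B` is strongly positive. -/
theorem isStronglyPositive_baston {n : ℕ} (hn : 1 ≤ n) {B : LinearMap.BilinForm ℝ (HSpace n)}
    (hB : ∀ v w, B v w = B w v)
    (hpos : ∀ v, 0 ≤ ∑ e, B (rmul (unitQ e) v) (rmul (unitQ e) v)) :
    IsStronglyPositive 1 (baston B) := by
  -- Averaging keeps the Baston element but makes the form positive semidefinite, which `B` itself
  -- need not be.
  let Q : LinearMap.BilinForm ℝ (HSpace n) := ∑ e, (4⁻¹ : ℝ) • rotForm B (unitQ e)
  have hQB : baston Q = baston B := by
    rw [baston_sum]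
    simp only [baston_rotForm_unitQ hB]
    rw [← Finset.sum_smul]
    simp
  have hQapp : ∀ v w, Q v w = 4⁻¹ * ∑ e, rotForm B (unitQ e) v w := fun v w => by
    simp [Q, LinearMap.coe_sum, Finset.mul_sum]
  have hQs : LinearMap.IsSymm Q := ⟨fun v w => by
    simp only [RingHom.id_apply, hQapp, rotForm_symm hB _ v w]⟩
  obtain ⟨b, hb⟩ := LinearMap.BilinForm.exists_orthogonal_basis hQs
  -- In an orthogonal basis `Q` is a sum of squares of coordinate forms with coefficients `Q (b i)
  -- (b i)`.
  have hQsum : Q = ∑ i, Q (b i) (b i) • LinearMap.BilinForm.linMulLin (b.coord i) (b.coord i) := by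
    refine b.ext fun i => b.ext fun j => ?_
    simp only [LinearMap.coe_sum, Finset.sum_apply, bilinForm_smul_apply,
      LinearMap.BilinForm.linMulLin_apply, Module.Basis.coord_apply, Module.Basis.repr_self]
    by_cases h : i = j
    · subst h
      simp [Finsupp.single_apply]
    · have h1 : Q (b i) (b j) = 0 := hb h
      rw [h1, Finset.sum_eq_zero]
      intro k _
      rcases eq_or_ne i k with rfl | hk
      · simp [Ne.symm h]
      · simp [Finsupp.single_apply, hk]
  rw [← hQB, hQsum, baston_sum]
  simp only [baston_mul_self]
  refine isStronglyPositive_one_sum hn (fun i => ?_) _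
  rw [hQapp]
  exact mul_nonneg (by norm_num) (hpos _)

/-! ### Positivity of the complex determinant of a quaternionic matrix -/

/-- `τ(a)` as a matrix. -/
noncomputable def tauMat (a : ℍ[ℝ]) : Matrix (Fin 2) (Fin 2) ℂ := Matrix.of (tau a)

theorem tauMat_mul (a b : ℍ[ℝ]) : tauMat (a * b) = tauMat a * tauMat b := by
  ext ε δ
  fin_cases ε <;> fin_cases δ <;>
    simp [tauMat, tau, Matrix.mul_apply, Fin.sum_univ_two] <;>
    apply Complex.ext <;> simp <;> ring

theorem tauMat_sub (a b : ℍ[ℝ]) : tauMat (a - b) = tauMat a - tauMat b := by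
  ext ε δ
  fin_cases ε <;> fin_cases δ <;> simp [tauMat, tau] <;> ring

theorem tauMat_one : tauMat 1 = 1 := by
  ext ε δ
  fin_cases ε <;> fin_cases δ <;> simp [tauMat, tau]

theorem det_tauMat (a : ℍ[ℝ]) : (tauMat a).det = ((‖a‖ ^ 2 : ℝ) : ℂ) := by
  rw [sq, ← Quaternion.normSq_eq_norm_mul_self, Quaternion.normSq_def', Matrix.det_fin_two]
  simp [tauMat, tau]
  apply Complex.ext <;> simp [sq] <;> ring

theorem continuous_tau (ε δ : Fin 2) : Continuous fun a => tau a ε δ := by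
  have h := Quaternion.continuous_re
  have h1 := Quaternion.continuous_imI
  have h2 := Quaternion.continuous_imJ
  have h3 := Quaternion.continuous_imK
  fin_cases ε <;> fin_cases δ <;> simp [tau] <;> fun_prop

/-- The complex `2m × 2m` matrix `τ(A)` of a quaternionic `m × m` matrix `A`. -/
noncomputable def tauBlock {m : Type*} (A : m → m → ℍ[ℝ]) : Matrix (m × Fin 2) (m × Fin 2) ℂ :=
  Matrix.of fun p q => tau (A p.1 q.1) p.2 q.2

/-- The index splitting for the Schur complement of the upper left block. -/
noncomputable def succBlockEquiv (k : ℕ) : Fin 2 ⊕ Fin k × Fin 2 ≃ Fin (k + 1) × Fin 2 where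
  toFun := Sum.elim (fun ε => (0, ε)) fun p => (p.1.succ, p.2)
  invFun p := Fin.cases (motive := fun _ => Fin 2 ⊕ Fin k × Fin 2) (Sum.inl p.2)
    (fun i => Sum.inr (i, p.2)) p.1
  left_inv := by rintro (ε | ⟨i, ε⟩) <;> simp
  right_inv := by
    rintro ⟨i, ε⟩
    refine Fin.cases ?_ (fun i => ?_) i <;> simp

/-- Because `τ` is multiplicative and additive, the complex Schur complement of the upper left `2 ×
2` block is `τ` of the quaternionic Schur complement; and `det τ(a) = ‖a‖ ^ 2`. -/
theorem det_tauBlock_succ {k : ℕ} (A : Fin (k + 1) → Fin (k + 1) → ℍ[ℝ]) (h : A 0 0 ≠ 0) :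
    (tauBlock A).det = ((‖A 0 0‖ ^ 2 : ℝ) : ℂ) *
      (tauBlock fun i l : Fin k => A i.succ l.succ - A i.succ 0 * (A 0 0)⁻¹ * A 0 l.succ).det := by
  rw [← Matrix.det_submatrix_equiv_self (succBlockEquiv k)]
  have hinv1 : tauMat (A 0 0) * tauMat (A 0 0)⁻¹ = 1 := by
    rw [← tauMat_mul, mul_inv_cancel₀ h, tauMat_one]
  have hinv2 : tauMat (A 0 0)⁻¹ * tauMat (A 0 0) = 1 := by
    rw [← tauMat_mul, inv_mul_cancel₀ h, tauMat_one]
  let _ : Invertible (tauMat (A 0 0)) := ⟨tauMat (A 0 0)⁻¹, hinv2, hinv1⟩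
  have hblock : (tauBlock A).submatrix (succBlockEquiv k) (succBlockEquiv k)
      = Matrix.fromBlocks (tauMat (A 0 0)) (Matrix.of fun ε q => tau (A 0 q.1.succ) ε q.2)
        (Matrix.of fun p δ => tau (A p.1.succ 0) p.2 δ)
        (tauBlock fun i l => A i.succ l.succ) := by
    ext (ε | ⟨i, ε⟩) (δ | ⟨l, δ⟩) <;> simp [tauBlock, succBlockEquiv, tauMat]
  rw [hblock, Matrix.det_fromBlocks₁₁, det_tauMat]
  refine congrArg _ (congrArg Matrix.det ?_)
  ext ⟨i, ε⟩ ⟨l, δ⟩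
  have h1 : tau (A i.succ l.succ - A i.succ 0 * (A 0 0)⁻¹ * A 0 l.succ) ε δ
      = (tauMat (A i.succ l.succ) -
        tauMat (A i.succ 0) * tauMat (A 0 0)⁻¹ * tauMat (A 0 l.succ)) ε δ := by
    rw [← tauMat_mul, ← tauMat_mul, ← tauMat_sub]
    rfl
  have h2 : (⅟(tauMat (A 0 0))) = tauMat (A 0 0)⁻¹ := rfl
  rw [h2]
  simp only [tauBlock, Matrix.sub_apply, Matrix.of_apply, h1]
  simp only [Matrix.mul_apply, Matrix.of_apply]
  rfl

/-- Induction on the size: each Schur complement splits off a factor `‖a‖ ^ 2`. A vanishing corner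
entry is perturbed, and the closed half-line `[0, ∞)` is stable under the limit. -/
theorem det_tauBlock_nonneg {k : ℕ} (A : Fin k → Fin k → ℍ[ℝ]) :
    0 ≤ (tauBlock A).det.re ∧ (tauBlock A).det.im = 0 := by
  induction k with
  | zero => simp
  | succ k ih =>
    have hne : ∀ A : Fin (k + 1) → Fin (k + 1) → ℍ[ℝ], A 0 0 ≠ 0 →
        0 ≤ (tauBlock A).det.re ∧ (tauBlock A).det.im = 0 := by
      intro A hA
      rw [det_tauBlock_succ A hA, Complex.re_ofReal_mul, Complex.im_ofReal_mul]
      obtain ⟨h1, h2⟩ := ih fun i l => A i.succ l.succ - A i.succ 0 * (A 0 0)⁻¹ * A 0 l.succ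
      exact ⟨mul_nonneg (by positivity) h1, by rw [h2, mul_zero]⟩
    by_cases hA : A 0 0 = 0
    · let P : ℝ → Fin (k + 1) → Fin (k + 1) → ℍ[ℝ] := fun t i l =>
        A i l + if i = 0 ∧ l = 0 then (t : ℍ[ℝ]) else 0
      have hP0 : P 0 = A := by ext1 i; ext1 l; simp [P]
      have hcont : Continuous fun t => (tauBlock (P t)).det := by
        refine Continuous.matrix_det (continuous_matrix fun p q => ?_)
        refine (continuous_tau p.2 q.2).comp (continuous_const.add ?_)
        split_ifs
        · exact Quaternion.continuous_coe
        · exact continuous_const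
      have hclosed : IsClosed {z : ℂ | 0 ≤ z.re ∧ z.im = 0} :=
        (isClosed_le continuous_const Complex.continuous_re).inter
          (isClosed_eq Complex.continuous_im continuous_const)
      have ht := (hcont.tendsto 0).mono_left (nhdsWithin_le_nhds (s := {0}ᶜ))
      rw [hP0] at ht
      refine hclosed.mem_of_tendsto ht ?_
      filter_upwards [self_mem_nhdsWithin] with t ht
      refine hne _ ?_
      simpa [P, hA, ← Quaternion.coe_zero, Quaternion.coe_inj] using ht
    · exact hne A hA

/-- The indices `j = 2l + ε` of `ℂ²ⁿ` as pairs `(l, ε)`. -/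
def blkParEquiv (n : ℕ) : Fin (2 * n) ≃ Fin n × Fin 2 where
  toFun j := (blk j, par j)
  invFun p := ⟨2 * p.1 + p.2, by have := p.1.2; have := p.2.2; omega⟩
  left_inv j := by ext; simp [blk, par]; omega
  right_inv p := by
    have := p.2.2
    ext <;> simp [blk, par] <;> omega

theorem prod_ofFn_pullback {n : ℕ} (η : Fin n → RightLin n) :
    (List.ofFn fun i => pullback (η i) 0 * pullback (η i) 1).prod
      = ExteriorAlgebra.ιMulti ℂ (2 * n) (fun j : Fin (2 * n) => fun k : Fin (2 * n) =>
          tau (η (blk j) (Pi.single (blk k) 1)) (par j) (par k)) := by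
  rw [ExteriorAlgebra.ιMulti_apply, List.ofFn_mul', List.prod_flatten, List.map_ofFn]
  congr 2
  ext1 i
  have h0 : ∀ h : 2 * (i : ℕ) + (0 : Fin 2) < 2 * n,
      (blk ⟨2 * (i : ℕ) + (0 : Fin 2), h⟩ : Fin n) = i ∧
      par (n := n) ⟨2 * (i : ℕ) + (0 : Fin 2), h⟩ = 0 := fun h => by
    constructor <;> ext <;> simp [blk, par]
  have h1 : ∀ h : 2 * (i : ℕ) + (1 : Fin 2) < 2 * n,
      (blk ⟨2 * (i : ℕ) + (1 : Fin 2), h⟩ : Fin n) = i ∧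
      par (n := n) ⟨2 * (i : ℕ) + (1 : Fin 2), h⟩ = 1 := fun h => by
    constructor <;> ext <;> simp [blk, par]; omega
  simp only [Function.comp, List.ofFn_succ, List.ofFn_zero, List.prod_cons, List.prod_nil, mul_one,
    Fin.succ_zero_eq_one, h0, h1, pullback]

theorem topCoeff_prod_pullback_nonneg {n : ℕ} (η : Fin n → RightLin n) :
    0 ≤ (topCoeff n (List.ofFn fun i => pullback (η i) 0 * pullback (η i) 1).prod).re ∧
      (topCoeff n (List.ofFn fun i => pullback (η i) 0 * pullback (η i) 1).prod).im = 0 := by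
  have h : topCoeff n (List.ofFn fun i => pullback (η i) 0 * pullback (η i) 1).prod
      = (tauBlock fun i l => η i (Pi.single l 1)).det := by
    rw [prod_ofFn_pullback, topCoeff, ExteriorAlgebra.liftAlternating_apply_ιMulti,
      Pi.single_eq_same, ← Matrix.det_submatrix_equiv_self (blkParEquiv n)]
    rfl
  rw [h]
  exact det_tauBlock_nonneg _

/-- By bilinearity it suffices to treat elementary elements. Their product is a product of `n`
pairs, whose top coefficient is the determinant of `τ` of the quaternionic matrix of the `n` maps.
-/
theorem topCoeff_mul_nonneg {n : ℕ} (hn : 1 ≤ n) {x y : Ext n} (hx : IsStronglyPositive 1 x)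
    (hy : IsStronglyPositive (n - 1) y) :
    0 ≤ (topCoeff n (x * y)).re ∧ (topCoeff n (x * y)).im = 0 := by
  obtain ⟨m, rfl⟩ : ∃ m, n = m + 1 := ⟨n - 1, by omega⟩
  obtain ⟨p, c, ξ, hc, hξ, rfl⟩ := hx
  obtain ⟨q, d, ζ, hd, hζ, rfl⟩ := hy
  have key : ∀ i j, 0 ≤ (topCoeff (m + 1) (ξ i * ζ j)).re ∧
      (topCoeff (m + 1) (ξ i * ζ j)).im = 0 := by
    intro i j
    obtain ⟨η, -, h1⟩ := hξ i
    obtain ⟨θ, -, h2⟩ := hζ j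
    have := topCoeff_prod_pullback_nonneg (n := m + 1) (Fin.cons (η 0) θ : Fin (m + 1) → _)
    rw [List.ofFn_succ, List.prod_cons] at this
    simp only [Fin.cons_zero, Fin.cons_succ] at this
    rw [h1, h2]
    simpa using this
  have hexp : topCoeff (m + 1) ((∑ i, (c i : ℂ) • ξ i) * ∑ j, (d j : ℂ) • ζ j)
      = ∑ i, ∑ j, ((c i * d j : ℝ) : ℂ) * topCoeff (m + 1) (ξ i * ζ j) := by
    rw [Finset.sum_mul_sum]
    simp only [map_sum, smul_mul_smul_comm, map_smul, smul_eq_mul, Complex.ofReal_mul]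
  rw [hexp, Complex.re_sum, Complex.im_sum]
  simp only [Complex.re_sum, Complex.im_sum, Complex.re_ofReal_mul, Complex.im_ofReal_mul,
    (key _ _).2, mul_zero, Finset.sum_const_zero, and_true]
  exact Finset.sum_nonneg fun i _ => Finset.sum_nonneg fun j _ =>
    mul_nonneg (mul_nonneg (hc i) (hd j)) (key i j).1

/-! ### Calculus of the operators `∇_{jα}` and `d_α` -/

section nabla

variable {n : ℕ} {W : Type*} [NormedAddCommGroup W] [NormedSpace ℂ W]
  {V : Type*} [NormedAddCommGroup V] [NormedSpace ℂ V]

theorem contDiffAt_nabla {m p : WithTop ℕ∞} {F : HSpace n → W} {q : HSpace n}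
    (hF : ContDiffAt ℝ p F q) (hm : m + 1 ≤ p) (j : Fin (2 * n)) (α : Fin 2) :
    ContDiffAt ℝ m (nabla j α F) q := by
  have h := hF.fderiv_right hm
  exact (h.clm_apply contDiffAt_const).add ((h.clm_apply contDiffAt_const).const_smul _)

theorem nabla_congr {F G : HSpace n → W} {q : HSpace n} (h : F =ᶠ[nhds q] G) (j : Fin (2 * n))
    (α : Fin 2) : nabla j α F q = nabla j α G q := by
  simp only [nabla, h.fderiv_eq]

theorem nabla_clm {F : HSpace n → W} {q : HSpace n} (hF : DifferentiableAt ℝ F q)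
    (L : W →L[ℂ] V) (j : Fin (2 * n)) (α : Fin 2) :
    nabla j α (fun x => L (F x)) q = L (nabla j α F q) := by
  have h : fderiv ℝ (fun x => L (F x)) q = (L.restrictScalars ℝ).comp (fderiv ℝ F q) :=
    ((L.restrictScalars ℝ).hasFDerivAt.comp q hF.hasFDerivAt).fderiv
  simp [nabla, h]

theorem nabla_sum {ι : Type*} (s : Finset ι) {F : ι → HSpace n → W} {q : HSpace n}
    (hF : ∀ i ∈ s, DifferentiableAt ℝ (F i) q) (j : Fin (2 * n)) (α : Fin 2) :
    nabla j α (fun x => ∑ i ∈ s, F i x) q = ∑ i ∈ s, nabla j α (F i) q := by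
  simp only [nabla, fderiv_fun_sum hF, FunLike.coe_sum, Finset.sum_apply,
    Finset.smul_sum, Finset.sum_add_distrib]

theorem nabla_nabla {F : HSpace n → W} {q : HSpace n} (hF : ContDiffAt ℝ 2 F q)
    (j k : Fin (2 * n)) (α β : Fin 2) :
    nabla j α (nabla k β F) q =
      (fderiv ℝ (fderiv ℝ F) q (dirRe j α) (dirRe k β)
        - fderiv ℝ (fderiv ℝ F) q (dirIm j α) (dirIm k β))
      + Complex.I • (fderiv ℝ (fderiv ℝ F) q (dirRe j α) (dirIm k β)
        + fderiv ℝ (fderiv ℝ F) q (dirIm j α) (dirRe k β)) := by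
  have hd : DifferentiableAt ℝ (fderiv ℝ F) q :=
    (hF.fderiv_right (m := 1) (by norm_num)).differentiableAt (by simp)
  have h1 : ∀ v : HSpace n, HasFDerivAt (fun x => fderiv ℝ F x v)
      ((fderiv ℝ (fderiv ℝ F) q).flip v) q := fun v => by
    have := hd.hasFDerivAt.clm_apply (hasFDerivAt_const v q)
    refine this.congr_fderiv ?_
    ext w; simp
  have h2 : fderiv ℝ (nabla k β F) q = (fderiv ℝ (fderiv ℝ F) q).flip (dirRe k β)
      + Complex.I • (fderiv ℝ (fderiv ℝ F) q).flip (dirIm k β) :=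
    ((h1 _).add ((h1 _).const_smul Complex.I)).fderiv
  rw [nabla, h2]
  simp only [add_apply, smul_apply, ContinuousLinearMap.flip_apply,
    smul_add, smul_smul, Complex.I_mul_I, neg_smul, one_smul]
  abel

theorem nabla_comm {F : HSpace n → W} {q : HSpace n} (hF : ContDiffAt ℝ 2 F q)
    (j k : Fin (2 * n)) (α β : Fin 2) :
    nabla j α (nabla k β F) q = nabla k β (nabla j α F) q := by
  have hsym : ∀ v w, fderiv ℝ (fderiv ℝ F) q v w = fderiv ℝ (fderiv ℝ F) q w v :=
    hF.isSymmSndFDerivAt (by simp)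
  rw [nabla_nabla hF, nabla_nabla hF, hsym (dirRe j α), hsym (dirRe j α), hsym (dirIm j α),
    hsym (dirIm j α), add_comm (fderiv ℝ (fderiv ℝ F) q (dirIm k β) (dirRe j α))]

end nabla

theorem toExt_wedgeLeft {n k m : ℕ} (h : k + 1 = m) (j : Fin (2 * n)) (x : ExtPow n k) :
    toExt (wedgeLeft h j x) = omega j * toExt x := rfl

theorem toExt_injective {n p : ℕ} : Function.Injective (toExt : ExtPow n p → Ext n) :=
  Subtype.val_injective

theorem wedgeLeft_wedgeLeft_comm {n p k m : ℕ} (h : k + 1 = m) (h' : p + 1 = k)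
    (i j : Fin (2 * n)) (x : ExtPow n p) :
    wedgeLeft h i (wedgeLeft h' j x) = -wedgeLeft h j (wedgeLeft h' i x) := by
  apply toExt_injective
  rw [map_neg, toExt_wedgeLeft, toExt_wedgeLeft, toExt_wedgeLeft, toExt_wedgeLeft, ← mul_assoc,
    omega_mul_omega_comm, neg_mul, mul_assoc]

theorem contDiffAt_dForm {n k l : ℕ} {m p : WithTop ℕ∞} {F : HSpace n → ExtPow n k}
    {q : HSpace n} (hF : ContDiffAt ℝ p F q) (hm : m + 1 ≤ p) (α : Fin 2) (h : k + 1 = l) :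
    ContDiffAt ℝ m (dForm α h F) q := by
  unfold QPot.dForm
  refine ContDiffAt.sum fun j _ => ?_
  exact ((wedgeLeft h j).restrictScalars ℝ).contDiff.contDiffAt.comp q (contDiffAt_nabla hF hm j α)

theorem dForm_dForm {n p k m : ℕ} (h : k + 1 = m) (h' : p + 1 = k) {F : HSpace n → ExtPow n p}
    {q : HSpace n} (hF : ContDiffAt ℝ 2 F q) (α β : Fin 2) :
    dForm α h (dForm β h' F) q
      = ∑ i, ∑ j, wedgeLeft h i (wedgeLeft h' j (nabla i α (nabla j β F) q)) := by
  have hd : ∀ j, DifferentiableAt ℝ (nabla j β F) q := fun j =>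
    (contDiffAt_nabla (m := 1) hF (by norm_num) j β).differentiableAt (by simp)
  unfold dForm
  refine Finset.sum_congr rfl fun i _ => ?_
  rw [nabla_sum, map_sum]
  · refine Finset.sum_congr rfl fun j _ => ?_
    rw [nabla_clm (hd j)]
  · intro j _
    exact ((wedgeLeft h' j).restrictScalars ℝ).differentiableAt.comp q (hd j)

theorem dForm_anticomm {n p k m : ℕ} (h : k + 1 = m) (h' : p + 1 = k) {F : HSpace n → ExtPow n p}
    {q : HSpace n} (hF : ContDiffAt ℝ 2 F q) (α β : Fin 2) :
    dForm α h (dForm β h' F) q = -dForm β h (dForm α h' F) q := by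
  rw [dForm_dForm h h' hF, dForm_dForm h h' hF, Finset.sum_comm]
  simp only [← Finset.sum_neg_distrib]
  refine Finset.sum_congr rfl fun j _ => Finset.sum_congr rfl fun i _ => ?_
  rw [wedgeLeft_wedgeLeft_comm, nabla_comm hF]

theorem dForm_dForm_self {n p k m : ℕ} (h : k + 1 = m) (h' : p + 1 = k)
    {F : HSpace n → ExtPow n p} {q : HSpace n} (hF : ContDiffAt ℝ 2 F q) (α : Fin 2) :
    dForm α h (dForm α h' F) q = 0 := by
  have h1 := dForm_anticomm h h' hF α α
  have h2 : (2 : ℂ) • dForm α h (dForm α h' F) q = 0 := by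
    rw [two_smul]
    nth_rw 1 [h1]
    exact neg_add_cancel _
  exact (smul_eq_zero.1 h2).resolve_left two_ne_zero

theorem dForm_congr {n k m : ℕ} {α : Fin 2} {h : k + 1 = m} {F G : HSpace n → ExtPow n k}
    {q : HSpace n} (hFG : F =ᶠ[nhds q] G) : dForm α h F q = dForm α h G q := by
  unfold dForm
  refine Finset.sum_congr rfl fun j _ => ?_
  rw [nabla_congr hFG]

theorem dForm_neg {n k m : ℕ} {α : Fin 2} {h : k + 1 = m} {F : HSpace n → ExtPow n k}
    {q : HSpace n} : dForm α h (fun x => -F x) q = -dForm α h F q := by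
  simp only [dForm, nabla, fderiv_fun_neg, neg_apply, smul_neg, map_add, map_neg,
    Finset.sum_add_distrib, Finset.sum_neg_distrib]
  abel

/-- `d_α △ = 0` on forms of class `C³`. -/
theorem dForm_dForm_dForm {n p k l m : ℕ} (h : l + 1 = m) (h' : k + 1 = l) (h'' : p + 1 = k)
    {F : HSpace n → ExtPow n p} {q : HSpace n} (hF : ContDiffAt ℝ 3 F q) (α : Fin 2) :
    dForm α h (dForm 0 h' (dForm 1 h'' F)) q = 0 := by
  have h2 : ∀ β, ContDiffAt ℝ 2 (dForm β h'' F) q := fun β =>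
    contDiffAt_dForm hF (by norm_num) β h''
  -- For `α = 1` the inner operators are exchanged so that `d₁d₁` appears. The exchange must hold on
  -- a neighbourhood, since it is differentiated once more.
  have hev : dForm 0 h' (dForm 1 h'' F) =ᶠ[nhds q] fun x => -dForm 1 h' (dForm 0 h'' F) x := by
    filter_upwards [hF.eventually (by simp)] with x hx
    exact dForm_anticomm h' h'' (hx.of_le (by norm_num)) 0 1
  match α with
  | 0 => exact dForm_dForm_self h h' (h2 1) 0
  | 1 => rw [dForm_congr hev, dForm_neg, dForm_dForm_self h h' (h2 0) 1, neg_zero]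

/-- The second derivative as a bilinear form. -/
noncomputable def sndForm {n : ℕ} (v : HSpace n → ℝ) (q : HSpace n) :
    LinearMap.BilinForm ℝ (HSpace n) :=
  LinearMap.mk₂ ℝ (fun x y => fderiv ℝ (fderiv ℝ v) q x y) (by simp) (by simp) (by simp) (by simp)

theorem sndForm_apply {n : ℕ} (v : HSpace n → ℝ) (q x y : HSpace n) :
    sndForm v q x y = fderiv ℝ (fderiv ℝ v) q x y := rfl

theorem nabla_nabla_ofReal {n : ℕ} {v : HSpace n → ℝ} {q : HSpace n} (hv : ContDiffAt ℝ 2 v q)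
    (j k : Fin (2 * n)) (α β : Fin 2) :
    nabla j α (nabla k β fun x => (v x : ℂ)) q = nablaCoeff (sndForm v q) α β j k := by
  have h0 : ContDiffAt ℝ 2 (fun x => (v x : ℂ)) q := Complex.ofRealCLM.contDiff.contDiffAt.comp q hv
  have h1 : fderiv ℝ (fun x => (v x : ℂ)) =ᶠ[nhds q]
      fun x => Complex.ofRealCLM.comp (fderiv ℝ v x) := by
    filter_upwards [hv.eventually (by simp)] with x hx
    exact (Complex.ofRealCLM.hasFDerivAt.comp x
      (hx.differentiableAt (by simp)).hasFDerivAt).fderiv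
  have hd : DifferentiableAt ℝ (fderiv ℝ v) q :=
    (hv.fderiv_right (m := 1) (by norm_num)).differentiableAt (by simp)
  have h2 : ∀ x y, fderiv ℝ (fderiv ℝ fun x => (v x : ℂ)) q x y
      = (fderiv ℝ (fderiv ℝ v) q x y : ℂ) := by
    intro x y
    rw [h1.fderiv_eq]
    have := (((ContinuousLinearMap.compL ℝ (HSpace n) ℝ ℂ) Complex.ofRealCLM).hasFDerivAt.comp q
      hd.hasFDerivAt).fderiv
    simp only [Function.comp_def, ContinuousLinearMap.compL_apply] at this
    rw [this]
    rfl
  rw [nabla_nabla h0]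
  simp only [h2, nablaCoeff, sndForm_apply, smul_eq_mul]
  push_cast
  ring

theorem contDiffAt_scalarForm {n : ℕ} {p : WithTop ℕ∞} {v : HSpace n → ℝ} {q : HSpace n}
    (hv : ContDiffAt ℝ p v q) : ContDiffAt ℝ p (scalarForm fun q => (v q : ℂ)) q := by
  have h0 : ContDiffAt ℝ p (fun x => (v x : ℂ)) q := Complex.ofRealCLM.contDiff.contDiffAt.comp q hv
  exact (((ContinuousLinearMap.id ℂ ℂ).smulRight (oneForm n)).restrictScalars
    ℝ).contDiff.contDiffAt.comp q h0

/-- This reduces pointwise statements on the differential operator to algebra of the second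
derivative. -/
theorem toExt_bastonForm {n : ℕ} {v : HSpace n → ℝ} {q : HSpace n} (hv : ContDiffAt ℝ 2 v q) :
    toExt (bastonForm v q) = baston (sndForm v q) := by
  let L : ℂ →L[ℂ] ExtPow n 0 := (ContinuousLinearMap.id ℂ ℂ).smulRight (oneForm n)
  have h0 : ∀ x, ContDiffAt ℝ 2 v x → ContDiffAt ℝ 2 (fun x => (v x : ℂ)) x := fun x hx =>
    Complex.ofRealCLM.contDiff.contDiffAt.comp x hx
  have hL : (scalarForm fun q => (v q : ℂ)) = fun q => L (v q) := rfl
  have h1 := contDiffAt_scalarForm hv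
  have h2 : ∀ j k, nabla j 0 (nabla k 1 (scalarForm fun q => (v q : ℂ))) q
      = nablaCoeff (sndForm v q) 0 1 j k • oneForm n := by
    intro j k
    rw [← nabla_nabla_ofReal hv, hL]
    have hev : nabla k 1 (fun q => L (v q)) =ᶠ[nhds q]
        fun x => L (nabla k 1 (fun x => (v x : ℂ)) x) := by
      filter_upwards [hv.eventually (by simp)] with x hx
      exact nabla_clm ((h0 x hx).differentiableAt (by simp)) L k 1
    rw [nabla_congr hev, nabla_clm]
    · rfl
    · exact (contDiffAt_nabla (m := 1) (h0 q hv) (by norm_num) k 1).differentiableAt (by simp)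
  rw [bastonForm, dForm_dForm _ _ h1]
  simp only [h2, map_sum, map_smul, toExt_wedgeLeft]
  have h3 : toExt (oneForm n) = 1 := rfl
  simp only [h3, mul_one, baston]

/-! ### Integration by parts -/

theorem hasCompactSupport_nabla {n : ℕ} {W : Type*} [NormedAddCommGroup W] [NormedSpace ℂ W]
    {F : HSpace n → W} (hF : HasCompactSupport F) (j : Fin (2 * n)) (α : Fin 2) :
    HasCompactSupport (nabla j α F) := by
  refine (hF.fderiv (𝕜 := ℝ)).mono' fun x hx => ?_
  by_contra h
  have h0 : fderiv ℝ F x = 0 := image_eq_zero_of_notMem_tsupport h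
  exact hx (by simp [QPot.nabla, h0])

theorem integral_mul_nabla {n : ℕ} {g w : HSpace n → ℂ} (hg : ContDiff ℝ 1 g)
    (hw : ContDiff ℝ 1 w) (hc : HasCompactSupport w) (j : Fin (2 * n)) (α : Fin 2) :
    ∫ q, g q * nabla j α w q = -∫ q, nabla j α g q * w q := by
  have hgd := hg.continuous_fderiv (by simp)
  have hwd := hw.continuous_fderiv (by simp)
  have i1 : ∀ v : HSpace n, Integrable fun q => g q * fderiv ℝ w q v := fun v =>
    (hg.continuous.mul (hwd.clm_apply continuous_const)).integrable_of_hasCompactSupport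
      ((hc.fderiv_apply (𝕜 := ℝ) v).mul_left)
  have i2 : ∀ v : HSpace n, Integrable fun q => fderiv ℝ g q v * w q := fun v =>
    ((hgd.clm_apply continuous_const).mul hw.continuous).integrable_of_hasCompactSupport
      hc.mul_left
  have i3 : Integrable fun q => g q * w q :=
    (hg.continuous.mul hw.continuous).integrable_of_hasCompactSupport hc.mul_left
  have key : ∀ v : HSpace n, ∫ q, g q * fderiv ℝ w q v = -∫ q, fderiv ℝ g q v * w q := fun v =>
    integral_mul_fderiv_eq_neg_fderiv_mul_of_integrable (i2 v) (i1 v) i3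
      (fun x _ => hg.differentiable (by simp) x) (fun x _ => hw.differentiable (by simp) x)
  have e1 : ∀ q, g q * nabla j α w q
      = g q * fderiv ℝ w q (dirRe j α) + Complex.I * (g q * fderiv ℝ w q (dirIm j α)) := fun q => by
    simp only [nabla, smul_eq_mul]; ring
  have e2 : ∀ q, nabla j α g q * w q
      = fderiv ℝ g q (dirRe j α) * w q + Complex.I * (fderiv ℝ g q (dirIm j α) * w q) := fun q => by
    simp only [nabla, smul_eq_mul]; ring
  simp only [e1, e2]
  rw [integral_add (i1 _) ((i1 _).const_mul _), integral_add (i2 _) ((i2 _).const_mul _),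
    integral_const_mul, integral_const_mul, key, key]
  ring

theorem integral_mul_nabla_nabla {n : ℕ} {g w : HSpace n → ℂ} (hg : ContDiff ℝ 2 g)
    (hw : ContDiff ℝ 2 w) (hc : HasCompactSupport w) (j k : Fin (2 * n)) (α β : Fin 2) :
    ∫ q, g q * nabla j α (nabla k β w) q = ∫ q, nabla j α (nabla k β g) q * w q := by
  have hn : ∀ {f : HSpace n → ℂ} (_ : ContDiff ℝ 2 f) (i γ), ContDiff ℝ 1 (nabla i γ f) :=
    fun hf i γ => contDiff_iff_contDiffAt.2 fun x =>
      contDiffAt_nabla hf.contDiffAt (by norm_num) i γ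
  rw [integral_mul_nabla (hg.of_le (by norm_num)) (hn hw k β) (hasCompactSupport_nabla hc k β),
    integral_mul_nabla (hn hg j α) (hw.of_le (by norm_num)) hc, neg_neg]
  congr 1
  ext q
  rw [nabla_comm hg.contDiffAt]

/-- The linear form `x ↦ ∫ ωʲ ∧ ωᵏ ∧ x`. -/
noncomputable def wedgeTop {n p : ℕ} (j k : Fin (2 * n)) : ExtPow n p →L[ℂ] ℂ :=
  LinearMap.toContinuousLinearMap
    (topCoeff n ∘ₗ LinearMap.mulLeft ℂ (omega j * omega k) ∘ₗ toExt)

theorem wedgeTop_apply {n p : ℕ} (j k : Fin (2 * n)) (x : ExtPow n p) :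
    wedgeTop j k x = topCoeff n (omega j * omega k * toExt x) := rfl

/-- The pairing is a sum over `i, j` of scalar pairings with the test functions `wedgeTop i j (η
q)`. In each one two integrations by parts move both derivatives to `g`, and the two signs cancel.
-/
theorem integral_mul_baston {n p k m : ℕ} (h : k + 1 = m) (h' : p + 1 = k) {g : HSpace n → ℝ}
    (hg : ContDiff ℝ 2 g) {η : HSpace n → ExtPow n p} (hη : ContDiff ℝ 2 η)
    (hc : HasCompactSupport η) :
    ∫ q, (g q : ℂ) * topCoeff n (toExt (dForm 0 h (dForm 1 h' η) q))
      = ∫ q, topCoeff n (baston (sndForm g q) * toExt (η q)) := by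
  have hgc : ContDiff ℝ 2 fun q => (g q : ℂ) := Complex.ofRealCLM.contDiff.comp hg
  have hw : ∀ i j, ContDiff ℝ 2 fun q => wedgeTop (p := p) i j (η q) := fun i j =>
    ((wedgeTop i j).restrictScalars ℝ).contDiff.comp hη
  have hwc : ∀ i j, HasCompactSupport fun q => wedgeTop (p := p) i j (η q) := fun i j =>
    hc.comp_left (map_zero _)
  have hn : ∀ {f : HSpace n → ℂ} (_ : ContDiff ℝ 2 f) (i j α β),
      Continuous (nabla i α (nabla j β f)) :=
    fun hf i j α β => ContDiff.continuous (𝕜 := ℝ) (n := 0) (contDiff_iff_contDiffAt.2 fun x =>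
      contDiffAt_nabla (contDiffAt_nabla (m := 1) hf.contDiffAt (by norm_num) j β) (by simp) i α)
  have e1 : ∀ q, topCoeff n (toExt (dForm 0 h (dForm 1 h' η) q))
      = ∑ i, ∑ j, nabla i 0 (nabla j 1 fun q => wedgeTop i j (η q)) q := by
    intro q
    rw [dForm_dForm h h' hη.contDiffAt]
    simp only [map_sum, toExt_wedgeLeft]
    refine Finset.sum_congr rfl fun i _ => Finset.sum_congr rfl fun j _ => ?_
    have h1 : (nabla j 1 fun q => wedgeTop i j (η q)) = fun q => wedgeTop i j (nabla j 1 η q) :=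
      funext fun x => nabla_clm (hη.differentiable (by norm_num) x) _ j 1
    rw [h1, nabla_clm, wedgeTop_apply, mul_assoc]
    exact (contDiffAt_nabla (m := 1) hη.contDiffAt (by norm_num) j 1).differentiableAt (by simp)
  have e2 : ∀ q, topCoeff n (baston (sndForm g q) * toExt (η q))
      = ∑ i, ∑ j, nabla i 0 (nabla j 1 fun q => (g q : ℂ)) q * wedgeTop i j (η q) := by
    intro q
    simp only [baston, Finset.sum_mul, map_sum, smul_mul_assoc, map_smul, smul_eq_mul,
      wedgeTop_apply, nabla_nabla_ofReal hg.contDiffAt]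
  simp only [e1, e2, Finset.mul_sum]
  have i1 : ∀ i j, Integrable fun q =>
      (g q : ℂ) * nabla i 0 (nabla j 1 fun q => wedgeTop (p := p) i j (η q)) q := fun i j =>
    (hgc.continuous.mul (hn (hw i j) i j 0 1)).integrable_of_hasCompactSupport
      (hasCompactSupport_nabla (hasCompactSupport_nabla (hwc i j) j 1) i 0).mul_left
  have i2 : ∀ i j, Integrable fun q =>
      nabla i 0 (nabla j 1 fun q => (g q : ℂ)) q * wedgeTop (p := p) i j (η q) := fun i j =>
    ((hn hgc i j 0 1).mul (hw i j).continuous).integrable_of_hasCompactSupport (hwc i j).mul_left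
  rw [integral_finsetSum _ fun i _ => integrable_finsetSum _ fun j _ => i1 i j,
    integral_finsetSum _ fun i _ => integrable_finsetSum _ fun j _ => i2 i j]
  refine Finset.sum_congr rfl fun i _ => ?_
  rw [integral_finsetSum _ fun j _ => i1 i j, integral_finsetSum _ fun j _ => i2 i j]
  exact Finset.sum_congr rfl fun j _ => integral_mul_nabla_nabla hgc (hw i j) (hwc i j) i j 0 1

/-! ### Currents defined by functions -/

/-- A `C²` function on an open set agrees near a compact subset with a global `C²` function. -/
theorem exists_contDiff_eventuallyEq {E : Type*} [NormedAddCommGroup E] [NormedSpace ℝ E]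
    [FiniteDimensional ℝ E] {U K : Set E} (hU : IsOpen U) (hK : IsCompact K) (hKU : K ⊆ U)
    {v : E → ℝ} (hv : ContDiffOn ℝ 2 v U) :
    ∃ g : E → ℝ, ContDiff ℝ 2 g ∧ ∀ x ∈ K, g =ᶠ[nhds x] v := by
  obtain ⟨t, ht, hKt, htU⟩ := exists_compact_between hK hU hKU
  obtain ⟨f, hf1, hf0, -⟩ := exists_contMDiffMap_one_nhds_of_subset_interior
    (modelWithCornersSelf ℝ E) (n := 2) hK.isClosed hKt
  have hf : ContDiff ℝ 2 f := f.contMDiff.contDiff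
  refine ⟨fun x => f x * v x, contDiff_iff_contDiffAt.2 fun x => ?_, fun x hx => ?_⟩
  · by_cases hx : x ∈ U
    · exact hf.contDiffAt.mul (hv.contDiffAt (hU.mem_nhds hx))
    · refine (contDiffAt_const (c := (0 : ℝ))).congr_of_eventuallyEq ?_
      filter_upwards [ht.isClosed.isOpen_compl.mem_nhds fun h => hx (htU h)] with y hy
      rw [hf0 y hy, zero_mul]
  · filter_upwards [(Filter.eventually_iff.1 hf1 |> nhds_le_nhdsSet hx)] with y hy
    rw [show f y = 1 from hy, one_mul]

theorem sndForm_congr {n : ℕ} {v w : HSpace n → ℝ} {q : HSpace n} (h : v =ᶠ[nhds q] w) :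
    sndForm v q = sndForm w q := by
  refine LinearMap.ext₂ fun x y => ?_
  rw [sndForm_apply, sndForm_apply, h.fderiv.fderiv_eq]

theorem integral_mul_baston_of_contDiffOn {n p k m : ℕ} (h : k + 1 = m) (h' : p + 1 = k)
    {Ω : Opens (HSpace n)} {v : HSpace n → ℝ} (hv : ContDiffOn ℝ 2 v Ω) (η : TestForm Ω p) :
    ∫ q in (Ω : Set (HSpace n)), (v q : ℂ) * topCoeff n (toExt (dForm 0 h (dForm 1 h' η) q))
      = ∫ q in (Ω : Set (HSpace n)), topCoeff n (baston (sndForm v q) * toExt (η q)) := by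
  -- Agreement near the support, not merely on it, is needed to identify the second derivatives
  -- there.
  obtain ⟨g, hg, hgv⟩ := exists_contDiff_eventuallyEq Ω.isOpen η.hasCompactSupport
    η.tsupport_subset hv
  have hη : ContDiff ℝ 2 η := η.contDiff.of_le (WithTop.coe_le_coe.2 le_top)
  have hz : ∀ q, q ∉ tsupport η → η =ᶠ[nhds q] 0 := fun q hq =>
    notMem_tsupport_iff_eventuallyEq.1 hq
  have h0 : ∀ q, q ∉ tsupport η → dForm 0 h (dForm 1 h' η) q = 0 := fun q hq => by
    have e : dForm 1 h' η =ᶠ[nhds q] 0 := by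
      filter_upwards [(hz q hq).eventually_nhds] with x hx
      rw [dForm_congr hx]
      simp [dForm, nabla]
    rw [dForm_congr e]
    simp [dForm, nabla]
  have h1 : ∀ q, q ∉ tsupport η → η q = 0 := fun q hq => (hz q hq).self_of_nhds
  rw [setIntegral_eq_integral_of_forall_compl_eq_zero fun q hq => ?_,
    setIntegral_eq_integral_of_forall_compl_eq_zero fun q hq => ?_]
  · have := integral_mul_baston h h' hg hη η.hasCompactSupport
    convert this using 2
    · ext q
      by_cases hq : q ∈ tsupport η
      · rw [(hgv q hq).self_of_nhds]
      · rw [h0 q hq]; simp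
    · ext q
      by_cases hq : q ∈ tsupport η
      · rw [sndForm_congr (hgv q hq)]
      · rw [h1 q hq]; simp
  · rw [h1 q fun hq' => hq (η.tsupport_subset hq')]; simp
  · rw [h0 q fun hq' => hq (η.tsupport_subset hq')]; simp

theorem locallyIntegrableOn_scalarForm {n : ℕ} {Ω : Opens (HSpace n)} {f : HSpace n → ℂ}
    (hf : LocallyIntegrableOn f (Ω : Set (HSpace n))) :
    LocallyIntegrableOn (scalarForm f) (Ω : Set (HSpace n)) := fun x hx => by
  obtain ⟨U, hU, h⟩ := hf x hx
  exact ⟨U, hU, h.smul_const (oneForm n)⟩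

/-- A locally integrable function defines a `0`-current. -/
theorem exists_current {n : ℕ} {Ω : Opens (HSpace n)} {f : HSpace n → ℂ}
    (hf : LocallyIntegrableOn f (Ω : Set (HSpace n))) :
    ∃ U : Current Ω 0, IsCurrentOf U (scalarForm f) ∧
      ∀ φ : TestForm Ω (2 * n - 0), U φ = ∫ q in (Ω : Set (HSpace n)),
        f q * topCoeff n (toExt (φ q)) := by
  let T : ExtPow n (2 * n - 0) →L[ℂ] ℂ :=
    LinearMap.toContinuousLinearMap (topCoeff n ∘ₗ toExt)
  let B : ExtPow n (2 * n - 0) →L[ℂ] ℂ →L[ℂ] ℂ := (ContinuousLinearMap.mul ℂ ℂ).comp T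
  let U : Current Ω 0 := TestFunction.integralAgainstBilinCLM B volume f
  have hU : ∀ φ : TestForm Ω (2 * n - 0), U φ = ∫ q in (Ω : Set (HSpace n)),
      f q * topCoeff n (toExt (φ q)) := by
    intro φ
    have h1 : U φ = ∫ q, B (φ q) (f q) := TestFunction.integralAgainstBilinCLM_eq_integral hf
    have h2 : ∀ q, B (φ q) (f q) = f q * topCoeff n (toExt (φ q)) := fun q => mul_comm _ _
    simp only [h2] at h1
    rw [h1, setIntegral_eq_integral_of_forall_compl_eq_zero fun q hq => ?_]
    rw [image_eq_zero_of_notMem_tsupport fun hq' => hq (φ.tsupport_subset hq')]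
    simp
  refine ⟨U, ⟨locallyIntegrableOn_scalarForm hf, fun φ => ?_⟩, hU⟩
  rw [hU]
  congr 1
  ext q
  have h3 : toExt (scalarForm f q) = f q • (1 : Ext n) := rfl
  rw [h3, smul_mul_assoc, one_mul, map_smul, smul_eq_mul]

/-! ### Closedness of the Baston operator applied to a current -/

theorem dTest_dTest_comm {n p k m : ℕ} {Ω : Opens (HSpace n)} (h : k + 1 = m) (h' : p + 1 = k)
    (α β : Fin 2) (η : TestForm Ω p) : dTest α h (dTest β h' η) = -dTest β h (dTest α h' η) := by
  have hη : ContDiff ℝ 2 η := η.contDiff.of_le (WithTop.coe_le_coe.2 le_top)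
  have hd : ∀ γ, ⇑(dTest γ h' η) = dForm γ h' η := fun γ => funext fun x => dTest_apply γ h' η x
  ext q
  rw [neg_apply, dTest_apply, dTest_apply, hd, hd, dForm_anticomm h h' hη.contDiffAt]

theorem dTest_dTest_self {n p k m : ℕ} {Ω : Opens (HSpace n)} (h : k + 1 = m) (h' : p + 1 = k)
    (α : Fin 2) (η : TestForm Ω p) : dTest α h (dTest α h' η) = 0 := by
  have hη : ContDiff ℝ 2 η := η.contDiff.of_le (WithTop.coe_le_coe.2 le_top)
  have hd : ⇑(dTest α h' η) = dForm α h' η := funext fun x => dTest_apply α h' η x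
  ext q
  rw [dTest_apply, hd, dForm_dForm_self h h' hη.contDiffAt]
  rfl

theorem dTest_baston {n p k l m : ℕ} {Ω : Opens (HSpace n)} (h : l + 1 = m) (h' : k + 1 = l)
    (h'' : p + 1 = k) (α : Fin 2) (η : TestForm Ω p) :
    dTest 0 h (dTest 1 h' (dTest α h'' η)) = 0 := by
  match α with
  | 0 => rw [dTest_dTest_comm h' h'', map_neg, dTest_dTest_self h h', neg_zero]
  | 1 => rw [dTest_dTest_self h' h'', map_zero]

/-- By duality `d_α △ T` evaluates `-T` on `d₀ d₁ d_α η`, which vanishes for every test form `η`. -/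
theorem isClosedCurrent_bastonCurrent {n p : ℕ} {Ω : Opens (HSpace n)} (h : p + 2 ≤ 2 * n)
    (T : Current Ω p) : IsClosedCurrent (bastonCurrent h T) := by
  intro α h'
  ext η
  have := dTest_baston (Ω := Ω) (show (2 * n - (p + 2) + 1) + 1 = 2 * n - p by omega) rfl
    (show 2 * n - (p + 2 + 1) + 1 = 2 * n - (p + 2) by omega) α η
  simp only [dCurrent, bastonCurrent, neg_apply, ContinuousLinearMap.comp_apply, this, map_zero,
    neg_zero, zero_apply]

theorem bastonCurrent_apply {n : ℕ} {Ω : Opens (HSpace n)} (h : 0 + 2 ≤ 2 * n) {U : Current Ω 0}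
    {f : HSpace n → ℂ} (hU : ∀ φ : TestForm Ω (2 * n - 0), U φ = ∫ q in (Ω : Set (HSpace n)),
      f q * topCoeff n (toExt (φ q))) (η : TestForm Ω (2 * n - (0 + 2))) :
    bastonCurrent h U η = ∫ q in (Ω : Set (HSpace n)),
      f q * topCoeff n (toExt (dForm 0 (show (2 * n - (0 + 2) + 1) + 1 = 2 * n - 0 by omega)
        (dForm 1 rfl η) q)) := by
  simp only [bastonCurrent, ContinuousLinearMap.comp_apply, hU, dTest_apply]
  have hd : ⇑(dTest 1 rfl η) = dForm 1 rfl η := funext fun x => dTest_apply 1 rfl η x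
  rw [hd]

/-! ### Mollification -/

/-- The sub-mean value inequality at a point where `u` is finite. -/
theorem IsPSH.toReal_le_integral {n : ℕ} {Ω : Opens (HSpace n)} {u : HSpace n → EReal}
    (hu : IsPSH Ω u) (hm : Measurable u) {a v : HSpace n}
    (hΩ : ∀ t : ℍ[ℝ], ‖t‖ ≤ 1 → a + rmul t v ∈ Ω) (ha : u a ≠ ⊥) :
    (u a).toReal ≤ ∫ ξ : Metric.sphere (0 : ℍ[ℝ]) 1,
      (u (a + rmul (ξ : ℍ[ℝ]) v)).toReal ∂sphereProb := by
  have hK : IsCompact ((fun t : ℍ[ℝ] => a + rmul t v) '' Metric.closedBall 0 1) := by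
    exact (isCompact_closedBall _ _).image (continuous_add_rmul a v)
  obtain ⟨M, hM, hle⟩ := hu.exists_le_of_isCompact hK (by
    rintro _ ⟨t, ht, rfl⟩; exact hΩ t (by simpa using ht))
  have hle' : ∀ t : ℍ[ℝ], ‖t‖ ≤ 1 → u (a + rmul t v) ≤ M := fun t ht =>
    hle _ ⟨t, by simpa using ht, rfl⟩
  have h1 := hu.lintegral_gap_sphere_le hm hM hΩ hle'
  have ht : gap M u a ≠ ⊤ := by rwa [Ne, gap_eq_top_iff]
  have h2 := integrable_toReal_of_lintegral_gap (μ := sphereProb)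
    (f := fun ξ => u (a + rmul (ξ : ℍ[ℝ]) v)) (hm.comp (measurable_add_rmul_sphere a v)) (M := M)
    (Filter.Eventually.of_forall fun ξ => hle' _ (by simp)) (ne_top_of_le_ne_top ht h1)
  have h0 : u a ≤ M := by
    have := hle' 0 (by simp)
    rwa [show a + rmul 0 v = a by ext1 l; simp [rmul_apply]] at this
  rw [h2.2.2, toReal_eq_sub_gap h0 ha]
  have h3 := ENNReal.toReal_mono ht h1
  simp only [probReal_univ, one_mul]
  exact sub_le_sub_left h3 M

/-- Mollification of an integrable function. -/
noncomputable def mollify {n : ℕ} (φ : ContDiffBump (0 : HSpace n)) (w : HSpace n → ℝ) :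
    HSpace n → ℝ :=
  convolution (φ.normed volume) w (ContinuousLinearMap.lsmul ℝ ℝ) volume

theorem mollify_apply {n : ℕ} (φ : ContDiffBump (0 : HSpace n)) (w : HSpace n → ℝ)
    (x : HSpace n) : mollify φ w x = ∫ t, φ.normed volume t * w (x - t) := by
  simp [mollify, convolution_def]

theorem contDiff_mollify {n : ℕ} (φ : ContDiffBump (0 : HSpace n)) {w : HSpace n → ℝ}
    (hw : Integrable w) : ContDiff ℝ 2 (mollify φ w) :=
  (φ.hasCompactSupport_normed (μ := volume)).contDiff_convolution_left (n := 2) _ φ.contDiff_normed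
    hw.locallyIntegrable

theorem integrable_mollify_integrand {n : ℕ} (φ : ContDiffBump (0 : HSpace n)) {w : HSpace n → ℝ}
    (hw : Integrable w) (x : HSpace n) :
    Integrable fun t => φ.normed volume t * w (x - t) := by
  have h := (φ.hasCompactSupport_normed (μ := volume)).convolutionExists_left (μ := volume)
    (ContinuousLinearMap.lsmul ℝ ℝ) φ.continuous_normed hw.locallyIntegrable x
  simpa [ConvolutionExistsAt] using h

/-- If `w` agrees with a plurisubharmonic function near `x`, the mollification satisfies
the sub-mean value inequality at `x`. -/
theorem IsPSH.mollify_le_integral {n : ℕ} {Ω : Opens (HSpace n)} {u : HSpace n → EReal}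
    (hu : IsPSH Ω u) (hm : Measurable u) {w : HSpace n → ℝ} (hw : Integrable w)
    (hwm : Measurable w) {x v : HSpace n} {δ : ℝ} (φ : ContDiffBump (0 : HSpace n))
    (hφ : φ.rOut ≤ δ) (hv : ‖v‖ ≤ δ) (hΩ : Metric.ball x (2 * δ) ⊆ Ω)
    (hwu : ∀ y ∈ Metric.ball x (2 * δ), w y = (u y).toReal)
    (hfin : ∀ᵐ y, y ∈ (Ω : Set (HSpace n)) → u y ≠ ⊥) :
    mollify φ w x ≤ ∫ ξ : Metric.sphere (0 : ℍ[ℝ]) 1,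
      mollify φ w (x + rmul (ξ : ℍ[ℝ]) v) ∂sphereProb := by
  have hint : Integrable (fun p : HSpace n × Metric.sphere (0 : ℍ[ℝ]) 1 =>
      φ.normed volume p.1 * w (x + rmul (p.2 : ℍ[ℝ]) v - p.1)) (volume.prod sphereProb) := by
    have hmeas : Measurable fun p : HSpace n × Metric.sphere (0 : ℍ[ℝ]) 1 =>
        φ.normed volume p.1 * w (x + rmul (p.2 : ℍ[ℝ]) v - p.1) := by
      have h1 : Measurable (φ.normed (volume : Measure (HSpace n))) :=
        φ.continuous_normed.measurable
      have h2 : Measurable fun p : HSpace n × Metric.sphere (0 : ℍ[ℝ]) 1 =>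
          x + rmul (p.2 : ℍ[ℝ]) v :=
        Measurable.comp (g := fun ξ : Metric.sphere (0 : ℍ[ℝ]) 1 => x + rmul (ξ : ℍ[ℝ]) v)
          (f := Prod.snd) (measurable_add_rmul_sphere x v) measurable_snd
      have h3 : Measurable fun p : HSpace n × Metric.sphere (0 : ℍ[ℝ]) 1 =>
          x + rmul (p.2 : ℍ[ℝ]) v - p.1 := h2.sub measurable_fst
      exact (h1.comp measurable_fst).mul (hwm.comp h3)
    rw [integrable_prod_iff' hmeas.aestronglyMeasurable]
    have hi : ∀ ξ : Metric.sphere (0 : ℍ[ℝ]) 1,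
        Integrable fun t => φ.normed volume t * w (x + rmul (ξ : ℍ[ℝ]) v - t) := fun ξ =>
      integrable_mollify_integrand φ hw (x + rmul (ξ : ℍ[ℝ]) v)
    refine ⟨Filter.Eventually.of_forall hi, ?_⟩
    have e : ∀ ξ : Metric.sphere (0 : ℍ[ℝ]) 1,
        ∫ t, ‖φ.normed volume t * w (x + rmul (ξ : ℍ[ℝ]) v - t)‖
          = mollify φ (fun y => ‖w y‖) (x + rmul (ξ : ℍ[ℝ]) v) := fun ξ => by
      rw [mollify_apply]
      congr 1
      ext t
      rw [norm_mul, Real.norm_of_nonneg (φ.nonneg_normed t)]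
    simp only [e]
    exact integrable_sphereProb
      ((contDiff_mollify φ hw.norm).continuous.comp (continuous_add_rmul_sphere x v))
  have hswap : ∫ ξ : Metric.sphere (0 : ℍ[ℝ]) 1, mollify φ w (x + rmul (ξ : ℍ[ℝ]) v) ∂sphereProb
      = ∫ t, ∫ ξ : Metric.sphere (0 : ℍ[ℝ]) 1,
        φ.normed volume t * w (x + rmul (ξ : ℍ[ℝ]) v - t) ∂sphereProb := by
    simp only [mollify_apply]
    exact (integral_integral_swap hint).symm
  rw [hswap, mollify_apply]
  refine integral_mono_ae (integrable_mollify_integrand φ hw x) hint.integral_prod_left ?_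
  -- Finiteness at the centre is essential: `toReal` turns `-∞` into `0`, for which the sub-mean
  -- value inequality could fail.
  have hfin' : ∀ᵐ t : HSpace n, x - t ∈ (Ω : Set (HSpace n)) → u (x - t) ≠ ⊥ :=
    (Measure.measurePreserving_sub_left volume x).quasiMeasurePreserving.ae hfin
  filter_upwards [hfin'] with t ht
  rw [integral_const_mul]
  by_cases hφt : φ.normed volume t = 0
  · simp [hφt]
  refine mul_le_mul_of_nonneg_left ?_ (φ.nonneg_normed t)
  have htb : ‖t‖ < δ := by
    have : t ∈ Function.support (φ.normed volume) := hφt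
    rw [φ.support_normed_eq, mem_ball_zero_iff] at this
    exact this.trans_le hφ
  -- Translation by the mollifier and the motion along the line cost at most `δ` each, so all points
  -- stay where `w` agrees with `u`.
  have hmem : ∀ s : ℍ[ℝ], ‖s‖ ≤ 1 → x - t + rmul s v ∈ Metric.ball x (2 * δ) := fun s hs => by
    rw [mem_ball_iff_norm]
    have h1 : ‖rmul s v‖ ≤ δ := (norm_rmul_le s v).trans
      ((mul_le_of_le_one_right (norm_nonneg _) hs).trans hv)
    calc ‖x - t + rmul s v - x‖ = ‖rmul s v - t‖ := by congr 1; abel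
      _ ≤ ‖rmul s v‖ + ‖t‖ := norm_sub_le _ _
      _ < 2 * δ := by linarith
  have hxt : x - t ∈ Metric.ball x (2 * δ) := by
    have := hmem 0 (by simp)
    rwa [show x - t + rmul 0 v = x - t by ext1 l; simp [rmul_apply]] at this
  have h := hu.toReal_le_integral hm (a := x - t) (v := v) (fun s hs => hΩ (hmem s hs))
    (ht (hΩ hxt))
  rw [hwu _ hxt]
  refine h.trans (le_of_eq ?_)
  congr 1
  ext ξ
  rw [show x + rmul (ξ : ℍ[ℝ]) v - t = x - t + rmul (ξ : ℍ[ℝ]) v by abel,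
    hwu _ (hmem _ (by simp))]

/-- Mollification is symmetric with respect to the `L²` pairing. -/
theorem integral_mollify_mul {n : ℕ} (φ : ContDiffBump (0 : HSpace n)) {w : HSpace n → ℝ}
    (hw : Integrable w) {f : HSpace n → ℂ} (hf : Continuous f) (hfc : HasCompactSupport f) :
    ∫ x, (mollify φ w x : ℂ) * f x
      = ∫ y, (w y : ℂ) *
        convolution (φ.normed volume) f (ContinuousLinearMap.lsmul ℝ ℝ) volume y := by
  have hfi : Integrable f := hf.integrable_of_hasCompactSupport hfc
  obtain ⟨C, hC⟩ := φ.continuous_normed.bounded_above_of_compact_support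
    (φ.hasCompactSupport_normed (μ := volume))
  have hint : Integrable (fun p : HSpace n × HSpace n =>
      (φ.normed volume (p.1 - p.2) : ℂ) * (f p.1 * (w p.2 : ℂ))) (volume.prod volume) := by
    refine (hfi.mul_prod hw.ofReal).bdd_mul (c := C) ?_ ?_
    · exact (Complex.continuous_ofReal.comp (φ.continuous_normed.comp
        (continuous_fst.sub continuous_snd))).aestronglyMeasurable
    · refine Filter.Eventually.of_forall fun p => ?_
      rw [Complex.norm_real]
      exact hC _
  have e1 : ∀ x, (mollify φ w x : ℂ) * f x
      = ∫ y, (φ.normed volume (x - y) : ℂ) * (f x * (w y : ℂ)) := fun x => by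
    have : mollify φ w x = ∫ y, φ.normed volume (x - y) * w y := by
      simp only [mollify, convolution_eq_swap, ContinuousLinearMap.lsmul_apply, smul_eq_mul]
    rw [this, ← integral_complex_ofReal, ← integral_mul_const]
    congr 1
    ext y
    push_cast
    ring
  have e2 : ∀ y, (w y : ℂ) *
      convolution (φ.normed volume) f (ContinuousLinearMap.lsmul ℝ ℝ) volume y
      = ∫ x, (φ.normed volume (x - y) : ℂ) * (f x * (w y : ℂ)) := fun y => by
    rw [convolution_eq_swap, ← integral_const_mul]
    congr 1
    ext x
    -- Evenness of the bump function is what makes mollification self-adjoint.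
    rw [← φ.normed_neg (x - y), neg_sub]
    simp only [ContinuousLinearMap.lsmul_apply, Complex.real_smul]
    ring
  simp only [e1, e2]
  exact integral_integral_swap hint

/-! ### Positivity -/

theorem isClosed_nonneg_real : IsClosed {z : ℂ | 0 ≤ z.re ∧ z.im = 0} :=
  (isClosed_le continuous_const Complex.continuous_re).inter
    (isClosed_eq Complex.continuous_im continuous_const)

theorem integral_nonneg_real {X : Type*} [MeasurableSpace X] {μ : Measure X} {F : X → ℂ}
    (hF : ∀ x, 0 ≤ (F x).re ∧ (F x).im = 0) : 0 ≤ (∫ x, F x ∂μ).re ∧ (∫ x, F x ∂μ).im = 0 := by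
  have h : ∀ x, F x = ((F x).re : ℂ) := fun x => Complex.ext rfl (by simpa using (hF x).2)
  have h2 : ∫ x, F x ∂μ = ((∫ x, (F x).re ∂μ : ℝ) : ℂ) := by
    rw [← integral_complex_ofReal]
    exact integral_congr_ae (Filter.Eventually.of_forall h)
  rw [h2, Complex.ofReal_re, Complex.ofReal_im]
  exact ⟨integral_nonneg fun x => (hF x).1, rfl⟩

/-- For a mollified `u` the integration by parts is legitimate and the integrand is pointwise
non-negative. Shifting the mollification from `u` to the continuous factor `f` built from the test
form makes the limit a matter of uniform convergence. -/
theorem IsPSH.integral_baston_nonneg {n : ℕ} (hn : 1 ≤ n) {Ω : Opens (HSpace n)}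
    {u : HSpace n → EReal} (hu : IsPSH Ω u) (hm : Measurable u)
    (hloc : LocallyIntegrableOn (fun q => (u q).toReal) (Ω : Set (HSpace n)))
    (hfin : ∀ᵐ q ∂volume.restrict (Ω : Set (HSpace n)), u q ≠ ⊥) {p k m : ℕ} (h : k + 1 = m)
    (h' : p + 1 = k) (η : TestForm Ω p) (hη : ∀ q, IsStronglyPositive (n - 1) (toExt (η q))) :
    0 ≤ (∫ q in (Ω : Set (HSpace n)), ((u q).toReal : ℂ) *
        topCoeff n (toExt (dForm 0 h (dForm 1 h' η) q))).re ∧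
      (∫ q in (Ω : Set (HSpace n)), ((u q).toReal : ℂ) *
        topCoeff n (toExt (dForm 0 h (dForm 1 h' η) q))).im = 0 := by
  rw [ae_restrict_iff' Ω.isOpen.measurableSet] at hfin
  obtain ⟨δ₀, hδ₀, hKΩ⟩ := η.hasCompactSupport.isCompact.exists_cthickening_subset_open Ω.isOpen
    η.tsupport_subset
  set K := Metric.cthickening δ₀ (tsupport η) with hK
  have hKc : IsCompact K := η.hasCompactSupport.isCompact.cthickening
  set δ := δ₀ / 2 with hδ
  have hδ0 : 0 < δ := by positivity
  have hball : ∀ x ∈ tsupport η, Metric.ball x (2 * δ) ⊆ K := fun x hx => by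
    rw [show 2 * δ = δ₀ by rw [hδ]; ring]
    exact (Metric.ball_subset_thickening hx δ₀).trans (Metric.thickening_subset_cthickening _ _)
  -- Cutting off at the compact neighbourhood `K` makes `u` globally integrable without changing it
  -- within `2 * δ = δ₀` of the support.
  let w : HSpace n → ℝ := K.indicator fun q => (u q).toReal
  have hwm : Measurable w := hm.ereal_toReal.indicator hKc.measurableSet
  have hw : Integrable w :=
    (integrable_indicator_iff hKc.measurableSet).2 (hloc.integrableOn_compact_subset hKΩ hKc)
  let T : ExtPow n m →L[ℂ] ℂ := LinearMap.toContinuousLinearMap (topCoeff n ∘ₗ toExt)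
  let f : HSpace n → ℂ := fun q => T (dTest 0 h (dTest 1 h' η) q)
  have hf : Continuous f := T.continuous.comp (dTest 0 h (dTest 1 h' η)).continuous
  have hfc : HasCompactSupport f := (dTest 0 h (dTest 1 h' η)).hasCompactSupport.comp_left
    (map_zero T)
  have hff : ∀ q, f q = topCoeff n (toExt (dForm 0 h (dForm 1 h' η) q)) := fun q => by
    have hd : ⇑(dTest 1 h' η) = dForm 1 h' η := funext fun x => dTest_apply 1 h' η x
    change topCoeff n (toExt (dTest 0 h (dTest 1 h' η) q)) = _
    rw [dTest_apply, hd]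
  have hη0 : ∀ q, q ∉ tsupport η → η q = 0 := fun q hq => image_eq_zero_of_notMem_tsupport hq
  have hf0 : ∀ q, q ∉ tsupport η → f q = 0 := fun q hq => by
    have e0 : η =ᶠ[nhds q] 0 := notMem_tsupport_iff_eventuallyEq.1 hq
    have e : dForm 1 h' η =ᶠ[nhds q] 0 := by
      filter_upwards [e0.eventually_nhds] with x hx
      rw [dForm_congr hx]
      simp [dForm, nabla]
    rw [hff, dForm_congr e]
    simp [dForm, nabla]
  have hint : ∫ q in (Ω : Set (HSpace n)), ((u q).toReal : ℂ) *
      topCoeff n (toExt (dForm 0 h (dForm 1 h' η) q)) = ∫ q, (w q : ℂ) * f q := by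
    rw [setIntegral_eq_integral_of_forall_compl_eq_zero fun q hq => ?_]
    · congr 1
      ext q
      rw [← hff]
      by_cases hq : q ∈ tsupport η
      · have : w q = (u q).toReal := Set.indicator_of_mem (Metric.self_subset_cthickening _ hq) _
        rw [this]
      · rw [hf0 q hq, mul_zero, mul_zero]
    · rw [← hff, hf0 q fun hq' => hq (η.tsupport_subset hq'), mul_zero]
  -- the mollified integrals are non-negative
  have hmol : ∀ φ : ContDiffBump (0 : HSpace n), φ.rOut ≤ δ →
      0 ≤ (∫ q, (mollify φ w q : ℂ) * f q).re ∧ (∫ q, (mollify φ w q : ℂ) * f q).im = 0 := by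
    intro φ hφ
    have hg := contDiff_mollify φ hw
    simp only [hff]
    rw [integral_mul_baston h h' hg (η.contDiff.of_le (WithTop.coe_le_coe.2 le_top))
      η.hasCompactSupport]
    refine integral_nonneg_real fun q => ?_
    by_cases hq : q ∈ tsupport η
    · refine topCoeff_mul_nonneg hn (isStronglyPositive_baston hn ?_ fun v => ?_) (hη q)
      · exact hg.contDiffAt.isSymmSndFDerivAt (by simp)
      · refine sum_sndFDeriv_nonneg hg.contDiffAt ?_
        have hsmall : ∀ᶠ r : ℝ in nhdsWithin 0 (Set.Ioi 0), r * ‖v‖ < δ := by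
          have : Filter.Tendsto (fun r : ℝ => r * ‖v‖) (nhds 0) (nhds 0) := by
            simpa using (continuous_mul_const ‖v‖).tendsto (0 : ℝ)
          exact nhdsWithin_le_nhds (this.eventually (gt_mem_nhds hδ0))
        filter_upwards [hsmall, self_mem_nhdsWithin] with r hr hr0
        have := hu.mollify_le_integral hm hw hwm (x := q) (v := r • v) φ hφ
          (by rw [norm_smul, Real.norm_of_nonneg (le_of_lt hr0)]; exact hr.le)
          ((hball q hq).trans hKΩ)
          (fun y hy => Set.indicator_of_mem (hball q hq hy) _) hfin
        simpa only [map_smul] using this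
    · simp [hη0 q hq]
  rw [hint]
  -- The required sign condition is closed, so it is enough to approximate the integral within `ε`.
  -- The error is at most `‖w‖₁ · sup |f - f * φ|`; the choice `ε / (I + 1)` also covers `I = 0`.
  refine isClosed_nonneg_real.closure_subset (Metric.mem_closure_iff.2 fun ε hε => ?_)
  set I := ∫ q, ‖w q‖ with hI
  have hI0 : 0 ≤ I := integral_nonneg fun q => norm_nonneg _
  obtain ⟨ρ, hρ, hρf⟩ := Metric.uniformContinuous_iff.1
    (hfc.uniformContinuous_of_continuous hf) (ε / (I + 1)) (by positivity)
  have hr : 0 < min δ ρ := lt_min hδ0 hρ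
  let φ : ContDiffBump (0 : HSpace n) := ⟨min δ ρ / 2, min δ ρ, by positivity, by linarith⟩
  refine ⟨_, hmol φ (min_le_left _ _), ?_⟩
  rw [integral_mollify_mul φ hw hf hfc, dist_eq_norm, ← integral_sub]
  · calc ‖∫ y, ((w y : ℂ) * f y - (w y : ℂ) * convolution (φ.normed volume) f
            (ContinuousLinearMap.lsmul ℝ ℝ) volume y)‖
        ≤ ∫ y, ‖w y‖ * (ε / (I + 1)) := by
          refine norm_integral_le_of_norm_le (hw.norm.mul_const _)
            (Filter.Eventually.of_forall fun y => ?_)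
          rw [← mul_sub, norm_mul, Complex.norm_real, ← dist_eq_norm, dist_comm]
          refine mul_le_mul_of_nonneg_left ?_ (norm_nonneg _)
          refine ContDiffBump.dist_normed_convolution_le hf.aestronglyMeasurable fun x hx => ?_
          exact (hρf (lt_of_lt_of_le (Metric.mem_ball.1 hx) (min_le_right _ _))).le
      _ = I * (ε / (I + 1)) := by rw [integral_mul_const]
      _ < ε := by
          rw [mul_div_assoc', div_lt_iff₀ (by positivity)]
          nlinarith
  · obtain ⟨C, hC⟩ := hf.bounded_above_of_compact_support hfc
    exact hw.ofReal.mul_bdd (c := C) hf.aestronglyMeasurable (Filter.Eventually.of_forall hC)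
  · have hcs := (φ.hasCompactSupport_normed (μ := volume)).convolution
      (ContinuousLinearMap.lsmul ℝ ℝ) (μ := volume) hfc
    have hcc : Continuous
        (convolution (φ.normed volume) f (ContinuousLinearMap.lsmul ℝ ℝ) volume) :=
      (φ.hasCompactSupport_normed (μ := volume)).continuous_convolution_left _
        φ.continuous_normed (hf.integrable_of_hasCompactSupport hfc).locallyIntegrable
    obtain ⟨C, hC⟩ := hcc.bounded_above_of_compact_support hcs
    exact hw.ofReal.mul_bdd (c := C) hcc.aestronglyMeasurable (Filter.Eventually.of_forall hC)

/-- For a real valued `C²` function no mollification is needed: the mean value inequality feeds the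
second order test directly. -/
theorem IsPSH.isStronglyPositive_bastonForm {n : ℕ} (hn : 1 ≤ n) {Ω : Opens (HSpace n)}
    {v : HSpace n → ℝ} (hv : IsPSH Ω fun q => (v q : EReal))
    (hc : ContDiffOn ℝ 2 v (Ω : Set (HSpace n))) {q : HSpace n} (hq : q ∈ Ω) :
    IsStronglyPositive 1 (toExt (bastonForm v q)) := by
  classical
  have hcq : ContDiffAt ℝ 2 v q := hc.contDiffAt (Ω.isOpen.mem_nhds hq)
  rw [toExt_bastonForm hcq]
  refine isStronglyPositive_baston hn (hcq.isSymmSndFDerivAt (by simp)) fun x => ?_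
  refine sum_sndFDeriv_nonneg hcq ?_
  let u : HSpace n → EReal := fun q => if q ∈ Ω then (v q : EReal) else ⊥
  have hu : IsPSH Ω u := hv.congr fun q hq => (if_pos hq).symm
  have hm : Measurable u := hv.measurable_extend
  have huv : ∀ y ∈ Ω, u y = (v y : EReal) := fun y hy => if_pos hy
  obtain ⟨δ, hδ, hsub⟩ := Metric.isOpen_iff.1 Ω.isOpen q hq
  have hsmall : ∀ᶠ r : ℝ in nhdsWithin 0 (Set.Ioi 0), r * ‖x‖ < δ := by
    have : Filter.Tendsto (fun r : ℝ => r * ‖x‖) (nhds 0) (nhds 0) := by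
      simpa using (continuous_mul_const ‖x‖).tendsto (0 : ℝ)
    exact nhdsWithin_le_nhds (this.eventually (gt_mem_nhds hδ))
  filter_upwards [hsmall, self_mem_nhdsWithin] with r hr hr0
  have hmem : ∀ t : ℍ[ℝ], ‖t‖ ≤ 1 → q + rmul t (r • x) ∈ Ω := fun t ht => hsub (by
    rw [mem_ball_iff_norm, add_sub_cancel_left]
    refine (norm_rmul_le _ _).trans_lt ((mul_le_of_le_one_right (norm_nonneg _) ht).trans_lt ?_)
    rw [norm_smul, Real.norm_of_nonneg (le_of_lt hr0)]
    exact hr)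
  have h := hu.toReal_le_integral hm hmem (by rw [huv q hq]; exact EReal.coe_ne_bot _)
  rw [huv q hq, EReal.toReal_coe] at h
  refine h.trans (le_of_eq ?_)
  congr 1
  ext ξ
  rw [huv _ (hmem ξ (by simp)), EReal.toReal_coe, map_smul]

theorem continuousOn_bastonForm {n : ℕ} {Ω : Opens (HSpace n)} {v : HSpace n → ℝ}
    (hc : ContDiffOn ℝ 2 v (Ω : Set (HSpace n))) :
    ContinuousOn (bastonForm v) (Ω : Set (HSpace n)) := fun q hq => by
  have h1 := contDiffAt_scalarForm (hc.contDiffAt (Ω.isOpen.mem_nhds hq))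
  have h2 : ContDiffAt ℝ 0 (bastonForm v) q :=
    contDiffAt_dForm (contDiffAt_dForm (m := 1) h1 (by norm_num) 1 rfl) (by simp) 0 rfl
  exact h2.continuousAt.continuousWithinAt

end QPot

open QPot
theorem proposition3p6 (n : ℕ) (hn : 1 ≤ n) (Ω : Opens (HSpace n)) :
    (∀ u : HSpace n → EReal, IsPSH Ω u →
      (∀ a ∈ Ω, ∃ q ∈ connectedComponentIn (Ω : Set (HSpace n)) a, u q ≠ ⊥) →
      (∀ᵐ q ∂volume.restrict (Ω : Set (HSpace n)), u q ≠ ⊥) ∧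
      ∃ U : Current Ω 0, IsCurrentOf U (scalarForm fun q => ((u q).toReal : ℂ)) ∧
        IsClosedCurrent (bastonCurrent (by omega) U) ∧
        IsPositiveCurrent 1 (bastonCurrent (by omega) U)) ∧
    (∀ v : HSpace n → ℝ, IsPSH Ω (fun q => (v q : EReal)) →
      ContDiffOn ℝ 2 v (Ω : Set (HSpace n)) →
      (∀ q ∈ Ω, IsStronglyPositive 1 (toExt (bastonForm v q))) ∧
      (∃ V : Current Ω 0, IsCurrentOf V (scalarForm fun q => (v q : ℂ)) ∧
        IsCurrentOf (bastonCurrent (by omega) V) (bastonForm v) ∧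
        IsClosedCurrent (bastonCurrent (by omega) V)) ∧
      (ContDiffOn ℝ 3 v (Ω : Set (HSpace n)) →
        ∀ α, ∀ q ∈ Ω, dForm α rfl (bastonForm v) q = (0 : ExtPow n 3))) := by
  classical
  refine ⟨fun u₀ hu₀ hfin₀ => ?_, fun v hv hc => ⟨fun q hq => ?_, ?_, fun hc3 α q hq => ?_⟩⟩
  · let u : HSpace n → EReal := fun q => if q ∈ Ω then u₀ q else ⊥
    have huu : ∀ q ∈ Ω, u q = u₀ q := fun q hq => if_pos hq
    have hu : IsPSH Ω u := hu₀.congr fun q hq => (huu q hq).symm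
    have hm : Measurable u := hu₀.measurable_extend
    have hfin : ∀ a ∈ Ω, ∃ q ∈ connectedComponentIn (Ω : Set (HSpace n)) a, u q ≠ ⊥ := by
      intro a ha
      obtain ⟨q, hq, h⟩ := hfin₀ a ha
      exact ⟨q, hq, by rwa [huu q (connectedComponentIn_subset _ _ hq)]⟩
    have hne := hu.ae_ne_bot hm hfin
    have hloc := hu.locallyIntegrableOn hm hfin
    have hae : ∀ᵐ q ∂volume.restrict (Ω : Set (HSpace n)), u q = u₀ q :=
      (ae_restrict_iff' Ω.isOpen.measurableSet).2 (Filter.Eventually.of_forall huu)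
    have hloc₀ : LocallyIntegrableOn (fun q => ((u₀ q).toReal : ℂ)) (Ω : Set (HSpace n)) := by
      intro x hx
      obtain ⟨A, hA, hAi⟩ := hloc x hx
      refine ⟨A ∩ Ω, Filter.inter_mem hA self_mem_nhdsWithin, ?_⟩
      refine (Integrable.congr (hAi.mono_set Set.inter_subset_left) ?_).ofReal
      filter_upwards [ae_restrict_of_ae_restrict_of_subset Set.inter_subset_right hae] with q hq
      exact congrArg EReal.toReal hq
    refine ⟨?_, ?_⟩
    · filter_upwards [hne, hae] with q h1 h2
      rwa [← h2]
    · obtain ⟨U, hU, hU'⟩ := exists_current hloc₀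
      refine ⟨U, hU, isClosedCurrent_bastonCurrent _ U, fun η hη => ?_⟩
      have key := hu.integral_baston_nonneg hn hm hloc hne
        (show (2 * n - (0 + 2) + 1) + 1 = 2 * n - 0 by omega) rfl η hη
      have e : bastonCurrent (by omega) U η = ∫ q in (Ω : Set (HSpace n)), ((u q).toReal : ℂ) *
          topCoeff n (toExt (dForm 0 (show (2 * n - (0 + 2) + 1) + 1 = 2 * n - 0 by omega)
            (dForm 1 rfl η) q)) := by
        rw [bastonCurrent_apply (by omega) hU']
        refine setIntegral_congr_fun Ω.isOpen.measurableSet fun q hq => ?_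
        simp only [huu q hq]
      rw [e]
      exact key
  · exact hv.isStronglyPositive_bastonForm hn hc hq
  · have hloc : LocallyIntegrableOn (fun q => (v q : ℂ)) (Ω : Set (HSpace n)) :=
      (Complex.continuous_ofReal.comp_continuousOn hc.continuousOn).locallyIntegrableOn
        Ω.isOpen.measurableSet
    obtain ⟨V, hV, hV'⟩ := exists_current hloc
    refine ⟨V, hV, ⟨(continuousOn_bastonForm hc).locallyIntegrableOn Ω.isOpen.measurableSet,
      fun φ => ?_⟩, isClosedCurrent_bastonCurrent _ V⟩
    rw [bastonCurrent_apply (by omega) hV', integral_mul_baston_of_contDiffOn _ rfl hc]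
    refine setIntegral_congr_fun Ω.isOpen.measurableSet fun q hq => ?_
    simp only [toExt_bastonForm (hc.contDiffAt (Ω.isOpen.mem_nhds hq))]
  · exact dForm_dForm_dForm _ _ _ (contDiffAt_scalarForm (hc3.contDiffAt (Ω.isOpen.mem_nhds hq))) α
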